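/- **Lemma (local Steiner formula for $C^2$-domains).** Let $n\ge 0$ and let $\Omega\subset\mathbb{R}^{n+1}$ be a bounded domain (nonempty, open, connected) with $C^2$-boundary, i.e. every $p\in\partial\Omega$ has an open neighbourhood $U$ with a $C^2$ function $\rho:U\to\mathbb{R}$, $d\rho\neq 0$ on $U$, such that $\Omega\cap U=\{x\in U:\rho(x)<0\}$. For $\varepsilon\ge 0$ let $\bar\Omega_\varepsilon=\{x\in\mathbb{R}^{n+1}:\operatorname{dist}(x,\bar\Omega)\le\varepsilon\}$ be the $\varepsilon$-parallel body. Let $\nu$ be the outward unit normal of $\partial\Omega$, and let $\kappa=(\kappa_1,\dots,\kappa_n)$ be the principal curvatures, i.e. the eigenvalues, with multiplicity, of the Weingarten operator $A(X)=D_X\nu$ on the tangent spaces of $\partial\Omega$. Let $s_m(\kappa)=\sum_{1\le i_1<\dots<i_m\le n}\kappa_{i_1}\cdots\kappa_{i_m}$ with $s_0=1$. Then the functions $s_0(\kappa),\dots,s_n(\kappa)$ are integrable over $\partial\Omega$ with respect to the surface measure, and there exists $\varepsilon_0>0$ such that for all $0\le\varepsilon<\varepsilon_0$ $$\operatorname{vol}(\bar\Omega_\varepsilon)=\sum_{k=0}^{n+1}\binom{n+1}{k}W_k(\Omega)\,\varepsilon^k,$$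 where $W_0(\Omega)=\operatorname{vol}(\Omega)$ and $$W_k(\Omega)=\frac{1}{(n+1)\binom{n}{k-1}}\int_{\partial\Omega}s_{k-1}(\kappa),\qquad 1\le k\le n+1.$$ -/

import Mathlib

open MeasureTheory Metric Topology Filter

noncomputable section

namespace SteinerFormula

/-- Euclidean space `ℝⁿ⁺¹`. -/
abbrev E (n : ℕ) : Type := EuclideanSpace ℝ (Fin (n + 1))

/-- A bounded domain (nonempty connected open set) with `C²` boundary: near each boundary point it is
the sublevel set `{ρ < 0}` of a `C²` function `ρ` with nowhere vanishing differential. -/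
structure IsBoundedC2Domain {n : ℕ} (Ω : Set (E n)) : Prop where
  isOpen : IsOpen Ω
  isConnected : IsConnected Ω
  isBounded : Bornology.IsBounded Ω
  boundary : ∀ p ∈ frontier Ω, ∃ (U : Set (E n)) (ρ : E n → ℝ), IsOpen U ∧ p ∈ U ∧
    ContDiffOn ℝ 2 ρ U ∧ (∀ x ∈ U, fderiv ℝ ρ x ≠ 0) ∧ ∀ x ∈ U, (x ∈ Ω ↔ ρ x < 0)

/-- `v` is an outward pointing unit normal to `∂Ω` at `p`: a unit vector, orthogonal to all
tangent vectors of `∂Ω` at `p`, which points out of `closure Ω`. -/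
def IsOutwardUnitNormal {n : ℕ} (Ω : Set (E n)) (p v : E n) : Prop :=
  ‖v‖ = 1 ∧ (∀ w ∈ tangentConeAt ℝ (frontier Ω) p, inner ℝ v w = 0) ∧
    ∀ᶠ t : ℝ in 𝓝[>] 0, p + t • v ∉ closure Ω

open Classical in
/-- The outward unit normal `ν` along `∂Ω` (for a `C²` domain there is exactly one at each boundary
point). -/
def outwardNormal {n : ℕ} (Ω : Set (E n)) (p : E n) : E n :=
  if h : ∃ v, IsOutwardUnitNormal Ω p v then h.choose else 0

/-- The tangent space `T_p ∂Ω = ν(p)^⊥`. -/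
abbrev tangentSpace {n : ℕ} (Ω : Set (E n)) (p : E n) : Submodule ℝ (E n) :=
  (Submodule.span ℝ {outwardNormal Ω p})ᗮ

/-- The Weingarten operator `A X = D_X ν` on `T_p ∂Ω`, where `D_X ν` is the derivative of `ν` along
the hypersurface `∂Ω`. (As `|ν| = 1`, the vector `D_X ν` is tangential, so the orthogonal projection
only serves to view it as an element of `T_p ∂Ω`. The value of `fderivWithin` on tangent vectors does
not depend on choices.) -/
def weingarten {n : ℕ} (Ω : Set (E n)) (p : E n) : tangentSpace Ω p →ₗ[ℝ] tangentSpace Ω p :=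
  ((tangentSpace Ω p).orthogonalProjectionOnto ∘L
    fderivWithin ℝ (outwardNormal Ω) (frontier Ω) p ∘L (tangentSpace Ω p).subtypeL).toLinearMap

/-- The principal curvatures `κ₁, …, κₙ` of `∂Ω` at `p`: the eigenvalues of the (self-adjoint)
Weingarten operator, listed with multiplicity. -/
def principalCurvatures {n : ℕ} (Ω : Set (E n)) (p : E n) : Multiset ℝ :=
  (weingarten Ω p).charpoly.roots

/-- `s_m(κ)` at `p ∈ ∂Ω`, the `m`-th elementary symmetric polynomial of the principal curvatures
(with `s_0 = 1`). -/
def sCurv {n : ℕ} (Ω : Set (E n)) (m : ℕ) (p : E n) : ℝ :=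
  (principalCurvatures Ω p).esymm m

/-- Surface measure on `∂Ω`: the `n`-dimensional Hausdorff measure, normalized to agree with Lebesgue
measure on `ℝⁿ`, restricted to `∂Ω`. -/
def surfaceMeasure {n : ℕ} (Ω : Set (E n)) : Measure (E n) :=
  (Measure.euclideanHausdorffMeasure n).restrict (frontier Ω)

/-- The numbers `W_k(Ω)`: `W_0 = vol Ω`, and
`W_k = ((n+1) * (n choose (k-1)))⁻¹ * ∫_{∂Ω} s_{k-1}(κ)` for `k ≥ 1`. -/
def W {n : ℕ} (Ω : Set (E n)) : ℕ → ℝ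
  | 0 => volume.real Ω
  | k + 1 => 1 / ((n + 1 : ℝ) * (n.choose k : ℝ)) * ∫ p, sCurv Ω k p ∂(surfaceMeasure Ω)

/-- The closed `ε`-parallel body `{x | dist (K, x) ≤ ε}` of a set `K`. -/
def parallelBody {n : ℕ} (K : Set (E n)) (ε : ℝ) : Set (E n) :=
  {x | infDist x K ≤ ε}

end SteinerFormula

end

/-! For small `ε` the collar `parallelBody (closure Ω) ε \ closure Ω` is the injective image of `∂Ω
× (0, ε]` under `(p, t) ↦ p + t ν(p)`, whose Jacobian is `det (1 + t A_p) = ∑ s_k(κ) t^k`.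
Integrating over `t` and then over `∂Ω` gives the polynomial, and the binomial normalization of `W`
absorbs the factors `1 / (k + 1)`.

Injectivity rests on one estimate: compactness and the `C²` condition give `C` with `|⟪ν(p), q - p⟫|
≤ C ‖q - p‖²` on `∂Ω`. For `2 C t < 1` it makes `p` the unique boundary point nearest to `p + t
ν(p)` (`sq_lt_norm_sub_sq`, `injOn_normalExp`). Surjectivity is the first-order condition at a
nearest point (`exists_nearest`).

The volume of the collar is computed against Hausdorff measure by localization. Near `p`, a chart
tangent to the identity flattens `∂Ω` into its tangent hyperplane; it and its inverse are
`K`-Lipschitz with `K` close to `1`, so it almost preserves `n`-dimensional measure. In flat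
coordinates the tube is the image of a product set under a map with derivative close to `1 + t A_p`.
Hence the tube over a small piece `B` has volume `μ(B) · tubeDensity` up to `δ μ(B)`
(`exists_tube_volume`). Both sides are additive in `B`, so compactness propagates the error bound to
all of `∂Ω` (`volume_tube`), and `δ → 0`.

The curvatures enter only through `det (1 + t A)`. `sum_sCurv_eq_det` rewrites it as a determinant
on the fixed ambient space, which yields both the continuity of each `s_k` and the link with the
Jacobian. -/

noncomputable section

namespace SteinerFormula

open Module Set
open scoped RealInnerProductSpace ENNReal NNReal

/-! ### Linear algebra: determinants and elementary symmetric functions -/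

section

/-- The **Weinstein–Aronszajn identity** for linear maps. -/
theorem det_one_add_comp_comm {V V' : Type*} [AddCommGroup V] [Module ℝ V] [FiniteDimensional ℝ V]
    [AddCommGroup V'] [Module ℝ V'] [FiniteDimensional ℝ V'] (f : V →ₗ[ℝ] V') (g : V' →ₗ[ℝ] V) :
    LinearMap.det (1 + f ∘ₗ g) = LinearMap.det (1 + g ∘ₗ f) := by
  let b := finBasis ℝ V
  let b' := finBasis ℝ V'
  rw [← LinearMap.det_toMatrix b', ← LinearMap.det_toMatrix b, map_add, map_add,
    LinearMap.toMatrix_comp b' b b', LinearMap.toMatrix_comp b b' b, LinearMap.toMatrix_one,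
    LinearMap.toMatrix_one, Matrix.det_one_add_mul_comm]

/-- For a symmetric operator `B`, `det (1 + t B)` is the generating function of the elementary
symmetric polynomials of the eigenvalues. -/
theorem det_one_add_smul_eq_sum_esymm {V : Type*} [NormedAddCommGroup V] [InnerProductSpace ℝ V]
    [FiniteDimensional ℝ V] {B : V →ₗ[ℝ] V} (hB : B.IsSymmetric) {n : ℕ} (hn : finrank ℝ V = n)
    (t : ℝ) :
    LinearMap.det (1 + t • B) = ∑ k ∈ Finset.range (n + 1), B.charpoly.roots.esymm k * t ^ k := by
  have hcard : B.charpoly.natDegree = n := by rw [LinearMap.charpoly_natDegree, hn]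
  rcases eq_or_ne t 0 with rfl | ht
  · rw [Finset.sum_eq_single 0]
    · simp [Multiset.esymm]
    · intro k _ hk
      simp [hk]
    · simp
  -- Pulling out `-t` exposes the characteristic polynomial at `-t⁻¹`; this is why `t = 0` is
  -- treated apart. Its coefficients are symmetric functions of the roots because a symmetric
  -- operator has a split characteristic polynomial.
  have h1 : (1 : V →ₗ[ℝ] V) + t • B = (-t) • (algebraMap ℝ (V →ₗ[ℝ] V) (-t⁻¹) - B) := by
    rw [smul_sub, Algebra.algebraMap_eq_smul_one, smul_smul]
    simp [ht]
  rw [h1, LinearMap.det_smul, hn, ← LinearMap.eval_charpoly, Polynomial.eval_eq_sum_range, hcard,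
    Finset.mul_sum, ← Finset.sum_range_reflect]
  refine Finset.sum_congr rfl fun k hk => ?_
  have hk' : k ≤ n := Nat.lt_succ_iff.mp (Finset.mem_range.mp hk)
  obtain ⟨m, rfl⟩ := Nat.exists_eq_add_of_le hk'
  rw [show k + m + 1 - 1 - k = m by omega,
    Polynomial.coeff_eq_esymm_roots_of_splits hB.splits_charpoly (by omega), hcard,
    (LinearMap.charpoly_monic B).leadingCoeff, show k + m - m = k by omega]
  have h2 : (-t) ^ (k + m) * (-t⁻¹) ^ m * (-1) ^ k = t ^ k := by
    rw [pow_add, mul_assoc ((-t) ^ k), ← mul_pow, neg_mul_neg, mul_inv_cancel₀ ht, one_pow,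
      mul_one, ← mul_pow]
    simp
  calc _ = B.charpoly.roots.esymm k * ((-t) ^ (k + m) * (-t⁻¹) ^ m * (-1) ^ k) := by ring
    _ = _ := by rw [h2]

/-- If the values of a polynomial at all points depend continuously on a parameter, then so do its
coefficients. -/
theorem continuousOn_coeff_of_continuousOn_eval {X : Type*} [TopologicalSpace X] {s : Set X} {n : ℕ}
    {c : ℕ → X → ℝ}
    (h : ∀ t : ℝ, ContinuousOn (fun x => ∑ k ∈ Finset.range (n + 1), c k x * t ^ k) s)
    {k : ℕ} (hk : k ≤ n) : ContinuousOn (c k) s := by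
  -- Sampling at the distinct nodes `0, …, n` and inverting the Vandermonde matrix writes each
  -- coefficient as a fixed linear combination of values.
  let v : Fin (n + 1) → ℝ := fun i => (i : ℝ)
  have hv : Function.Injective v := fun i j hij => Fin.ext (by simpa [v] using hij)
  have hdet : IsUnit (Matrix.vandermonde v).det :=
    (Matrix.det_vandermonde_ne_zero_iff.mpr hv).isUnit
  have key : ∀ x, c k x = ∑ i, (Matrix.vandermonde v)⁻¹ ⟨k, by omega⟩ i *
      ∑ j ∈ Finset.range (n + 1), c j x * v i ^ j := by
    intro x
    have h1 : (Matrix.vandermonde v)⁻¹.mulVec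
        ((Matrix.vandermonde v).mulVec fun j : Fin (n + 1) => c j x) =
          fun j : Fin (n + 1) => c j x := by
      rw [Matrix.mulVec_mulVec, Matrix.nonsing_inv_mul _ hdet, Matrix.one_mulVec]
    have h2 := congrFun h1 (⟨k, by omega⟩ : Fin (n + 1))
    simp only at h2
    rw [← h2, Matrix.mulVec, dotProduct]
    refine Finset.sum_congr rfl fun i _ => ?_
    rw [Matrix.mulVec, dotProduct, Finset.sum_range]
    congr 1
    exact Finset.sum_congr rfl fun j _ => by rw [Matrix.vandermonde_apply, mul_comm]
  refine ContinuousOn.congr ?_ fun x _ => key x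
  exact continuousOn_finsetSum _ fun i _ => continuousOn_const.mul (h _)

end

/-! ### Local defining functions and their normal fields -/

section

/-- A local description of `Ω` in an open set `U` as the sublevel set `{ρ < 0}` of a `C²` function
without critical points, together with the unit normal field `N = ∇ρ / |∇ρ|`. -/
structure LocalDefining {n : ℕ} (Ω U : Set (E n)) (ρ : E n → ℝ) (N : E n → E n) : Prop where
  isOpen : IsOpen U
  contDiffOn : ContDiffOn ℝ 2 ρ U
  contDiffOn_normal : ContDiffOn ℝ 1 N U
  norm_normal : ∀ x ∈ U, ‖N x‖ = 1
  fderiv_apply : ∀ x ∈ U, ∀ w, fderiv ℝ ρ x w = ‖fderiv ℝ ρ x‖ * ⟪N x, w⟫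
  fderiv_ne : ∀ x ∈ U, fderiv ℝ ρ x ≠ 0
  mem_iff : ∀ x ∈ U, x ∈ Ω ↔ ρ x < 0

variable {n : ℕ} {Ω U : Set (E n)} {ρ : E n → ℝ} {N : E n → E n} {p : E n}

theorem IsBoundedC2Domain.exists_localDefining (hΩ : IsBoundedC2Domain Ω) (hp : p ∈ frontier Ω) :
    ∃ U ρ N, p ∈ U ∧ LocalDefining Ω U ρ N := by
  obtain ⟨U, ρ, hU, hpU, hρ, hne, hmem⟩ := hΩ.boundary p hp
  let L := (InnerProductSpace.toDual ℝ (E n)).symm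
  have hg : ContDiffOn ℝ 1 (fun x => L (fderiv ℝ ρ x)) U :=
    L.toContinuousLinearEquiv.contDiff.comp_contDiffOn
      (hρ.fderiv_of_isOpen hU (by norm_num))
  have hg0 : ∀ x ∈ U, L (fderiv ℝ ρ x) ≠ 0 := fun x hx h => hne x hx (by simpa using h)
  refine ⟨U, ρ, fun x => ‖L (fderiv ℝ ρ x)‖⁻¹ • L (fderiv ℝ ρ x), hpU, hU, hρ,
    ((hg.norm ℝ hg0).inv fun x hx => norm_ne_zero_iff.mpr (hg0 x hx)).smul hg, fun x hx => ?_,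
    fun x hx w => ?_, hne, hmem⟩
  · rw [norm_smul, norm_inv, norm_norm, inv_mul_cancel₀ (norm_ne_zero_iff.mpr (hg0 x hx))]
  · rw [inner_smul_left, InnerProductSpace.toDual_symm_apply, LinearIsometryEquiv.norm_map]
    have := norm_ne_zero_iff.mpr (hne x hx)
    simp [this]

namespace LocalDefining

theorem contDiffAt (h : LocalDefining Ω U ρ N) {x : E n} (hx : x ∈ U) : ContDiffAt ℝ 2 ρ x :=
  h.contDiffOn.contDiffAt (h.isOpen.mem_nhds hx)

theorem contDiffAt_normal (h : LocalDefining Ω U ρ N) {x : E n} (hx : x ∈ U) :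
    ContDiffAt ℝ 1 N x :=
  h.contDiffOn_normal.contDiffAt (h.isOpen.mem_nhds hx)

theorem hasFDerivAt_normal (h : LocalDefining Ω U ρ N) {x : E n} (hx : x ∈ U) :
    HasFDerivAt N (fderiv ℝ N x) x :=
  ((h.contDiffAt_normal hx).differentiableAt one_ne_zero).hasFDerivAt

theorem hasFDerivAt (h : LocalDefining Ω U ρ N) {x : E n} (hx : x ∈ U) :
    HasFDerivAt ρ (fderiv ℝ ρ x) x :=
  ((h.contDiffAt hx).differentiableAt two_ne_zero).hasFDerivAt

theorem norm_fderiv_pos (h : LocalDefining Ω U ρ N) {x : E n} (hx : x ∈ U) :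
    0 < ‖fderiv ℝ ρ x‖ := norm_pos_iff.mpr (h.fderiv_ne x hx)

theorem continuousOn_fderiv_normal (h : LocalDefining Ω U ρ N) :
    ContinuousOn (fderiv ℝ N) U :=
  h.contDiffOn_normal.continuousOn_fderiv_of_isOpen h.isOpen le_rfl

/-- Differentiate `dρ(w) = dρ(N) ⟪N, w⟫` in the direction `v`: the term containing the derivative of
`dρ(N)` drops out because `⟪N x, w⟫ = 0`. Thus `dN` is, on tangent vectors, the Hessian of `ρ`
divided by `‖dρ‖`, and inherits its symmetry. -/
theorem inner_fderiv_normal (h : LocalDefining Ω U ρ N) {x : E n} (hx : x ∈ U) (v w : E n)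
    (hw : ⟪N x, w⟫ = 0) :
    fderiv ℝ (fderiv ℝ ρ) x v w = ‖fderiv ℝ ρ x‖ * ⟪fderiv ℝ N x v, w⟫ := by
  have hd : HasFDerivAt (fderiv ℝ ρ) (fderiv ℝ (fderiv ℝ ρ) x) x :=
    (((h.contDiffAt hx).fderiv_right (m := 1) (by norm_num)).differentiableAt
      one_ne_zero).hasFDerivAt
  have hN := h.hasFDerivAt_normal hx
  have h1 := hd.clm_apply (hasFDerivAt_const w x)
  have h2 := (hd.clm_apply hN).mul (hN.inner ℝ (hasFDerivAt_const w x))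
  have heq : (fun y => fderiv ℝ ρ y w) =ᶠ[𝓝 x] fun y => fderiv ℝ ρ y (N y) * ⟪N y, w⟫ := by
    filter_upwards [h.isOpen.mem_nhds hx] with y hy
    rw [h.fderiv_apply y hy w, h.fderiv_apply y hy (N y), real_inner_self_eq_norm_sq,
      h.norm_normal y hy]
    ring
  have h3 := congrArg (fun A => A v) (h1.unique (h2.congr_of_eventuallyEq heq))
  have h4 : fderiv ℝ ρ x (N x) = ‖fderiv ℝ ρ x‖ := by
    rw [h.fderiv_apply x hx, real_inner_self_eq_norm_sq, h.norm_normal x hx]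
    ring
  simpa [hw, h4] using h3

theorem inner_fderiv_normal_comm (h : LocalDefining Ω U ρ N) {x : E n} (hx : x ∈ U) {v w : E n}
    (hv : ⟪N x, v⟫ = 0) (hw : ⟪N x, w⟫ = 0) :
    ⟪fderiv ℝ N x v, w⟫ = ⟪v, fderiv ℝ N x w⟫ := by
  have h1 := h.inner_fderiv_normal hx v w hw
  have h2 := h.inner_fderiv_normal hx w v hv
  have h3 := (h.contDiffAt hx).isSymmSndFDerivAt (by simp) v w
  rw [h3, h2] at h1
  exact (mul_left_cancel₀ (h.norm_fderiv_pos hx).ne' h1).symm.trans (real_inner_comm _ _)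

theorem hasDerivAt_line (h : LocalDefining Ω U ρ N) {x : E n} (hx : x ∈ U) (v : E n) :
    HasDerivAt (fun t : ℝ => ρ (x + t • v)) (fderiv ℝ ρ x v) 0 := by
  have h1 : HasDerivAt (fun t : ℝ => x + t • v) v 0 := by
    simpa using ((hasDerivAt_id (0 : ℝ)).smul_const v).const_add x
  have h2 : HasFDerivAt ρ (fderiv ℝ ρ x) (x + (0 : ℝ) • v) := by simpa using h.hasFDerivAt hx
  exact h2.comp_hasDerivAt 0 h1

theorem fderiv_normal_apply (h : LocalDefining Ω U ρ N) {x : E n} (hx : x ∈ U) :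
    fderiv ℝ ρ x (N x) = ‖fderiv ℝ ρ x‖ := by
  rw [h.fderiv_apply x hx, real_inner_self_eq_norm_sq, h.norm_normal x hx]
  ring

theorem eventually_mem_line (h : LocalDefining Ω U ρ N) {x : E n} (hx : x ∈ U) (v : E n) :
    ∀ᶠ t : ℝ in 𝓝[>] 0, x + t • v ∈ U := by
  have h1 : Tendsto (fun t : ℝ => x + t • v) (𝓝[>] 0) (𝓝 x) := by
    have : Continuous (fun t : ℝ => x + t • v) := by fun_prop
    simpa using (this.tendsto 0).mono_left nhdsWithin_le_nhds
  exact h1.eventually (h.isOpen.mem_nhds hx)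

theorem eventually_pos (h : LocalDefining Ω U ρ N) {x : E n} (hx : x ∈ U) (h0 : ρ x = 0) :
    ∀ᶠ t : ℝ in 𝓝[>] 0, 0 < ρ (x + t • N x) := by
  have h1 := (h.hasDerivAt_line hx (N x)).tendsto_slope.mono_left
    (nhdsWithin_mono 0 (fun t (ht : t ∈ Ioi (0 : ℝ)) => (ne_of_gt ht : t ≠ 0)))
  rw [h.fderiv_normal_apply hx] at h1
  filter_upwards [h1.eventually (lt_mem_nhds (h.norm_fderiv_pos hx)), self_mem_nhdsWithin]
    with t ht ht0
  have ht0' : (0 : ℝ) < t := ht0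
  rw [slope_def_field] at ht
  simp only [zero_smul, add_zero, h0, sub_zero] at ht
  exact (div_pos_iff_of_pos_right ht0').mp ht

theorem eventually_neg (h : LocalDefining Ω U ρ N) {x : E n} (hx : x ∈ U) (h0 : ρ x = 0) {v : E n}
    (hv : ⟪N x, v⟫ < 0) : ∀ᶠ t : ℝ in 𝓝[>] 0, ρ (x + t • v) < 0 := by
  have h1 := (h.hasDerivAt_line hx v).tendsto_slope.mono_left
    (nhdsWithin_mono 0 (fun t (ht : t ∈ Ioi (0 : ℝ)) => (ne_of_gt ht : t ≠ 0)))
  have h2 : fderiv ℝ ρ x v < 0 := by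
    rw [h.fderiv_apply x hx]
    exact mul_neg_of_pos_of_neg (h.norm_fderiv_pos hx) hv
  filter_upwards [h1.eventually (gt_mem_nhds h2), self_mem_nhdsWithin] with t ht ht0
  have ht0' : (0 : ℝ) < t := ht0
  rw [slope_def_field] at ht
  simp only [zero_smul, add_zero, h0, sub_zero] at ht
  simpa using (div_lt_iff₀ ht0').mp ht

theorem inner_neg_normal_neg (h : LocalDefining Ω U ρ N) {x : E n} (hx : x ∈ U) :
    ⟪N x, -N x⟫ < 0 := by
  rw [inner_neg_right, real_inner_self_eq_norm_sq, h.norm_normal x hx]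
  norm_num

theorem notMem_closure (h : LocalDefining Ω U ρ N) {x : E n} (hx : x ∈ U) (hpos : 0 < ρ x) :
    x ∉ closure Ω := by
  intro hc
  have h1 : ∀ᶠ y in 𝓝 x, y ∉ Ω := by
    filter_upwards [h.isOpen.mem_nhds hx,
      (h.hasFDerivAt hx).continuousAt.eventually (lt_mem_nhds hpos)] with y hy hy'
    rw [h.mem_iff y hy]
    exact not_lt.mpr hy'.le
  exact (mem_closure_iff_frequently.mp hc) h1

/-- A zero of `ρ` is a limit of points of `Ω` because `ρ` decreases to first order along `-N`; a
point with `ρ > 0` has a neighbourhood missing `Ω`. -/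
theorem mem_frontier_iff (h : LocalDefining Ω U ρ N) (hΩ : IsOpen Ω) {x : E n} (hx : x ∈ U) :
    x ∈ frontier Ω ↔ ρ x = 0 := by
  rw [hΩ.frontier_eq]
  constructor
  · rintro ⟨h1, h2⟩
    rw [h.mem_iff x hx] at h2
    exact le_antisymm (not_lt.mp fun h3 => h.notMem_closure hx h3 h1) (not_lt.mp h2)
  · intro h0
    refine ⟨?_, by rw [h.mem_iff x hx]; simp [h0]⟩
    have h1 : Tendsto (fun t : ℝ => x + t • (-N x)) (𝓝[>] 0) (𝓝 x) := by
      have : Continuous (fun t : ℝ => x + t • (-N x)) := by fun_prop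
      simpa using (this.tendsto 0).mono_left nhdsWithin_le_nhds
    refine mem_closure_of_tendsto h1 ?_
    filter_upwards [h.eventually_neg hx h0 (h.inner_neg_normal_neg hx), h.eventually_mem_line hx (-N x)] with t ht ht'
    exact (h.mem_iff _ ht').mpr ht

end LocalDefining

end

/-! ### Flattening charts, the outward normal and the Weingarten operator -/

section

/-- A local `C¹` diffeomorphism `H` with inverse `φ` near `p`, tangent to the identity at `p`, which
maps `∂Ω` into the affine hyperplane through `p` orthogonal to `ν`. -/
structure FlatteningChart {n : ℕ} (Ω : Set (E n)) (p ν : E n) (φ H : E n → E n) : Prop where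
  map_base : H p = p
  symm_base : φ p = p
  contDiffAt_symm : ContDiffAt ℝ 1 φ p
  hasFDerivAt_symm : HasFDerivAt φ (ContinuousLinearMap.id ℝ (E n)) p
  hasStrictFDerivAt : HasStrictFDerivAt H (ContinuousLinearMap.id ℝ (E n)) p
  left_inv : ∀ᶠ x in 𝓝 p, φ (H x) = x
  right_inv : ∀ᶠ z in 𝓝 p, H (φ z) = z
  mem_frontier_iff : ∀ᶠ x in 𝓝 p, x ∈ frontier Ω ↔ ⟪ν, H x - p⟫ = 0

variable {n : ℕ} {Ω U : Set (E n)} {ρ : E n → ℝ} {N : E n → E n} {p : E n}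

namespace LocalDefining

theorem exists_flatteningChart (h : LocalDefining Ω U ρ N) (hΩ : IsOpen Ω) (hp : p ∈ U)
    (hpf : p ∈ frontier Ω) : ∃ φ H, FlatteningChart Ω p (N p) φ H := by
  have h0 : ρ p = 0 := (h.mem_frontier_iff hΩ hp).mp hpf
  set a := ‖fderiv ℝ ρ p‖ with ha
  have hapos : 0 < a := h.norm_fderiv_pos hp
  -- `H` replaces the normal coordinate `⟪N p, x - p⟫` by `a⁻¹ ρ x`. The two agree to first order at
  -- `p`, so `H` has derivative the identity there, and the inverse function theorem supplies `φ`.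
  let H : E n → E n := fun x => x + (a⁻¹ * ρ x - ⟪N p, x - p⟫) • N p
  have hHc : ContDiffAt ℝ 1 H p := by
    have h1 : ContDiffAt ℝ 1 ρ p := (h.contDiffAt hp).of_le (by norm_num)
    have h2 : ContDiffAt ℝ 1 (fun x : E n => ⟪N p, x - p⟫) p :=
      contDiffAt_const.inner ℝ (contDiffAt_id.sub contDiffAt_const)
    exact contDiffAt_id.add (((contDiffAt_const.mul h1).sub h2).smul contDiffAt_const)
  have hHd : HasFDerivAt H ((ContinuousLinearEquiv.refl ℝ (E n) : E n ≃L[ℝ] E n) :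
      E n →L[ℝ] E n) p := by
    have h1 := (h.hasFDerivAt hp).const_mul a⁻¹
    have h2 : HasFDerivAt (fun x : E n => ⟪N p, x - p⟫) (innerSL ℝ (N p)) p :=
      (innerSL ℝ (N p)).hasFDerivAt.comp p ((hasFDerivAt_id p).sub_const p)
    have h3 := (hasFDerivAt_id p).add ((h1.sub h2).smul_const (N p))
    refine h3.congr_fderiv ?_
    ext1 w
    have : a⁻¹ * fderiv ℝ ρ p w = ⟪N p, w⟫ := by
      rw [h.fderiv_apply p hp, ← ha, inv_mul_cancel_left₀ hapos.ne']
    simp [this]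
  have hHp : H p = p := by simp [H, h0]
  have hcont : ContDiffAt ℝ 1 (hHc.localInverse hHd one_ne_zero) (H p) :=
    hHc.to_localInverse hHd one_ne_zero
  have hs := hHc.hasStrictFDerivAt' hHd one_ne_zero
  have hL := hs.eventually_left_inverse
  have hR := hs.eventually_right_inverse
  have hd := hs.to_localInverse.hasFDerivAt
  have hb := hHc.localInverse_apply_image hHd one_ne_zero
  rw [hHp] at hcont hb hR hd
  refine ⟨hHc.localInverse hHd one_ne_zero, H, hHp, hb, hcont, hd, hs, hL, hR, ?_⟩
  filter_upwards [h.isOpen.mem_nhds hp] with x hx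
  have : ⟪N p, H x - p⟫ = a⁻¹ * ρ x := by
    have : H x - p = (x - p) + (a⁻¹ * ρ x - ⟪N p, x - p⟫) • N p := by simp only [H]; abel
    rw [this, inner_add_right, inner_smul_right, real_inner_self_eq_norm_sq, h.norm_normal p hp]
    ring
  rw [this, h.mem_frontier_iff hΩ hx]
  simp [hapos.ne']

/-- Along `∂Ω` the function `ρ` vanishes, so `dρ` and `0` are both derivatives within `∂Ω` and agree
on the tangent cone. Conversely, a line in the flat hyperplane is carried into `∂Ω` by `φ`, which
has derivative the identity at `p`. -/
theorem mem_tangentConeAt_iff (h : LocalDefining Ω U ρ N) (hΩ : IsOpen Ω) (hp : p ∈ U)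
    (hpf : p ∈ frontier Ω) (w : E n) : w ∈ tangentConeAt ℝ (frontier Ω) p ↔ ⟪N p, w⟫ = 0 := by
  constructor
  · intro hw
    have h1 : HasFDerivWithinAt ρ (fderiv ℝ ρ p) (frontier Ω) p :=
      (h.hasFDerivAt hp).hasFDerivWithinAt
    have h2 : HasFDerivWithinAt ρ (0 : E n →L[ℝ] ℝ) (frontier Ω) p := by
      refine (hasFDerivWithinAt_const (0 : ℝ) p (frontier Ω)).congr_of_eventuallyEq ?_
        ((h.mem_frontier_iff hΩ hp).mp hpf)
      filter_upwards [self_mem_nhdsWithin, mem_nhdsWithin_of_mem_nhds (h.isOpen.mem_nhds hp)]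
        with x hx hxU
      exact (h.mem_frontier_iff hΩ hxU).mp hx
    have h3 := h1.unique_on h2 hw
    rw [h.fderiv_apply p hp] at h3
    simpa [h.fderiv_ne p hp] using h3
  · intro hw
    obtain ⟨φ, H, hc⟩ := h.exists_flatteningChart hΩ hp hpf
    let s : Set (E n) := {z | φ z ∈ frontier Ω}
    have h1 : w ∈ tangentConeAt ℝ s p := by
      refine mem_tangentConeAt_of_add_smul_mem (l := 𝓝[≠] (0 : ℝ)) (c := id) tendsto_id ?_
      have h2 : Tendsto (fun t : ℝ => p + id t • w) (𝓝[≠] 0) (𝓝 p) := by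
        have : Continuous (fun t : ℝ => p + id t • w) := by unfold id; fun_prop
        simpa using (this.tendsto 0).mono_left nhdsWithin_le_nhds
      have h3 : Tendsto φ (𝓝 p) (𝓝 p) := by
        simpa [ContinuousAt, hc.symm_base] using hc.contDiffAt_symm.continuousAt
      filter_upwards [h2.eventually hc.right_inv, h2.eventually (h3.eventually hc.mem_frontier_iff)]
        with t ht1 ht2
      change φ _ ∈ frontier Ω
      rw [ht2, ht1]
      simp [inner_smul_right, hw]
    have h4 := hc.hasFDerivAt_symm.hasFDerivWithinAt.mapsTo_tangent_cone h1
    rw [hc.symm_base] at h4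
    refine tangentConeAt_mono ?_ h4
    rintro _ ⟨z, hz, rfl⟩
    exact hz

theorem isOutwardUnitNormal_iff (h : LocalDefining Ω U ρ N) (hΩ : IsOpen Ω) (hp : p ∈ U)
    (hpf : p ∈ frontier Ω) (v : E n) : IsOutwardUnitNormal Ω p v ↔ v = N p := by
  have h0 : ρ p = 0 := (h.mem_frontier_iff hΩ hp).mp hpf
  constructor
  · rintro ⟨hv1, hv2, hv3⟩
    have h1 : v = ⟪N p, v⟫ • N p := by
      have h2 : ⟪N p, v - ⟪N p, v⟫ • N p⟫ = 0 := by
        rw [inner_sub_right, inner_smul_right, real_inner_self_eq_norm_sq, h.norm_normal p hp]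
        ring
      have h3 := hv2 _ ((h.mem_tangentConeAt_iff hΩ hp hpf _).mpr h2)
      have h4 : ⟪v - ⟪N p, v⟫ • N p, v - ⟪N p, v⟫ • N p⟫ = 0 := by
        rw [inner_sub_left, h3, inner_smul_left, h2]
        simp
      exact sub_eq_zero.mp (inner_self_eq_zero.mp h4)
    have h2 : |⟪N p, v⟫| = 1 := by
      have := congrArg norm h1
      rwa [norm_smul, h.norm_normal p hp, hv1, mul_one, Real.norm_eq_abs, eq_comm] at this
    rcases (abs_eq zero_le_one).mp h2 with h3 | h3
    · rw [h3, one_smul] at h1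
      exact h1
    · rw [h3, neg_one_smul] at h1
      exfalso
      subst h1
      obtain ⟨t, ht1, ht2, ht3⟩ := (hv3.and ((h.eventually_neg hp h0 (h.inner_neg_normal_neg hp)).and
        (h.eventually_mem_line hp (-N p)))).exists
      exact ht1 (subset_closure ((h.mem_iff _ ht3).mpr ht2))
  · rintro rfl
    refine ⟨h.norm_normal p hp, fun w hw => (h.mem_tangentConeAt_iff hΩ hp hpf w).mp hw, ?_⟩
    filter_upwards [h.eventually_pos hp h0, h.eventually_mem_line hp (N p)] with t ht1 ht2
    exact h.notMem_closure ht2 ht1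

theorem outwardNormal_eq (h : LocalDefining Ω U ρ N) (hΩ : IsOpen Ω) (hp : p ∈ U)
    (hpf : p ∈ frontier Ω) : outwardNormal Ω p = N p := by
  have hex : ∃ v, IsOutwardUnitNormal Ω p v :=
    ⟨N p, (h.isOutwardUnitNormal_iff hΩ hp hpf _).mpr rfl⟩
  rw [outwardNormal, dif_pos hex]
  exact (h.isOutwardUnitNormal_iff hΩ hp hpf _).mp hex.choose_spec

/-- `N` extends `ν` off the hypersurface, and derivatives within `∂Ω` are determined on the tangent
cone, so the ambient derivative of `N` computes the Weingarten operator. -/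
theorem weingarten_apply (h : LocalDefining Ω U ρ N) (hΩ : IsOpen Ω) (hp : p ∈ U)
    (hpf : p ∈ frontier Ω) (X : tangentSpace Ω p) :
    weingarten Ω p X = (tangentSpace Ω p).orthogonalProjectionOnto (fderiv ℝ N p X) := by
  have h1 : HasFDerivWithinAt (outwardNormal Ω) (fderiv ℝ N p) (frontier Ω) p := by
    refine (h.hasFDerivAt_normal hp).hasFDerivWithinAt.congr_of_eventuallyEq ?_
      (h.outwardNormal_eq hΩ hp hpf)
    filter_upwards [self_mem_nhdsWithin, mem_nhdsWithin_of_mem_nhds (h.isOpen.mem_nhds hp)]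
      with x hx hxU
    exact h.outwardNormal_eq hΩ hxU hx
  have h2 : fderivWithin ℝ (outwardNormal Ω) (frontier Ω) p X = fderiv ℝ N p X := by
    refine h1.differentiableWithinAt.hasFDerivWithinAt.unique_on h1 ?_
    rw [h.mem_tangentConeAt_iff hΩ hp hpf, ← h.outwardNormal_eq hΩ hp hpf]
    exact Submodule.mem_orthogonal_singleton_iff_inner_right.mp X.2
  simp [weingarten, h2]

theorem weingarten_isSymmetric (h : LocalDefining Ω U ρ N) (hΩ : IsOpen Ω) (hp : p ∈ U)
    (hpf : p ∈ frontier Ω) : (weingarten Ω p).IsSymmetric := by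
  intro X Y
  rw [h.weingarten_apply hΩ hp hpf, h.weingarten_apply hΩ hp hpf,
    Submodule.inner_orthogonalProjectionOnto_eq_of_mem_right,
    Submodule.inner_orthogonalProjectionOnto_eq_of_mem_left]
  have key : ∀ X : tangentSpace Ω p, ⟪N p, X⟫ = 0 := fun X => by
    rw [← h.outwardNormal_eq hΩ hp hpf]
    exact Submodule.mem_orthogonal_singleton_iff_inner_right.mp X.2
  exact h.inner_fderiv_normal_comm hp (key X) (key Y)

end LocalDefining

/-- The orthogonal projection along a unit vector `ν`. -/
def projAlong (ν : E n) : E n →L[ℝ] E n :=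
  ContinuousLinearMap.id ℝ (E n) - (innerSL ℝ ν).smulRight ν

theorem projAlong_apply (ν v : E n) : projAlong ν v = v - ⟪ν, v⟫ • ν := by
  simp [projAlong]

theorem continuous_projAlong : Continuous (projAlong (n := n)) := by
  unfold projAlong
  fun_prop

theorem projAlong_eq_orthogonalProjectionOnto {ν : E n} (hν : ‖ν‖ = 1) (v : E n) :
    projAlong ν v = ((Submodule.span ℝ {ν})ᗮ.orthogonalProjectionOnto v : E n) := by
  rw [projAlong_apply]
  have := Submodule.starProjection_orthogonal_val (K := Submodule.span ℝ {ν}) v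
  rw [Submodule.starProjection_unit_singleton ℝ hν] at this
  exact this.symm

namespace LocalDefining

/-- The Weingarten operator is the projection to the tangent space composed with `dN` restricted to
it. Swapping the two factors moves the determinant to the ambient space, which no longer varies with
`p`. -/
theorem sum_sCurv_eq_det (h : LocalDefining Ω U ρ N) (hΩ : IsOpen Ω) (hp : p ∈ U)
    (hpf : p ∈ frontier Ω) (t : ℝ) :
    ∑ k ∈ Finset.range (n + 1), sCurv Ω k p * t ^ k =
      (ContinuousLinearMap.id ℝ (E n) + t • (fderiv ℝ N p ∘L projAlong (N p))).det := by
  have hν : ‖outwardNormal Ω p‖ = 1 := by rw [h.outwardNormal_eq hΩ hp hpf, h.norm_normal p hp]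
  have hfin : finrank ℝ (tangentSpace Ω p) = n := by
    have : Fact (finrank ℝ (E n) = n + 1) := ⟨by simp⟩
    exact Submodule.finrank_orthogonal_span_singleton (by rw [← norm_ne_zero_iff, hν]; exact one_ne_zero)
  have h1 := det_one_add_smul_eq_sum_esymm (h.weingarten_isSymmetric hΩ hp hpf) hfin t
  unfold sCurv principalCurvatures
  rw [← h1]
  let T := tangentSpace Ω p
  have h2 := det_one_add_comp_comm (T.orthogonalProjectionOnto.toLinearMap)
    ((t • (fderiv ℝ N p ∘L T.subtypeL)).toLinearMap)
  have h3 : T.orthogonalProjectionOnto.toLinearMap ∘ₗ (t • (fderiv ℝ N p ∘L T.subtypeL)).toLinearMap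
      = t • weingarten Ω p := by
    ext1 X
    simp [h.weingarten_apply hΩ hp hpf, T]
  rw [h3] at h2
  rw [h2, ContinuousLinearMap.det]
  congr 1
  ext1 v
  rw [← h.outwardNormal_eq hΩ hp hpf]
  simp [projAlong_eq_orthogonalProjectionOnto hν, T]

end LocalDefining

/-- No continuity of individual eigenvalues is needed: the ambient determinant is continuous in `p`
for every `t`, hence so are its coefficients in `t`. -/
theorem IsBoundedC2Domain.continuousOn_sCurv (hΩ : IsBoundedC2Domain Ω) {k : ℕ} (hk : k ≤ n) :
    ContinuousOn (sCurv Ω k) (frontier Ω) := by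
  refine continuousOn_coeff_of_continuousOn_eval (c := sCurv Ω) (n := n) (fun t => ?_) hk
  intro p hp
  obtain ⟨U, ρ, N, hpU, h⟩ := hΩ.exists_localDefining hp
  have h1 : ContinuousOn (fun x =>
      (ContinuousLinearMap.id ℝ (E n) + t • (fderiv ℝ N x ∘L projAlong (N x))).det) U := by
    refine ContinuousLinearMap.continuous_det.comp_continuousOn ?_
    exact continuousOn_const.add ((h.continuousOn_fderiv_normal.clm_comp
      (continuous_projAlong.comp_continuousOn h.contDiffOn_normal.continuousOn)).const_smul t)
  have h2 := (h1.continuousAt (h.isOpen.mem_nhds hpU)).continuousWithinAt (s := frontier Ω)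
  refine h2.congr_of_eventuallyEq ?_ (h.sum_sCurv_eq_det hΩ.isOpen hpU hp t)
  filter_upwards [self_mem_nhdsWithin, mem_nhdsWithin_of_mem_nhds (h.isOpen.mem_nhds hpU)]
    with x hx hxU
  exact h.sum_sCurv_eq_det hΩ.isOpen hxU hx t

end

/-! ### Quadratic contact with tangent planes and nearest points -/

section

variable {n : ℕ} {Ω U : Set (E n)} {ρ : E n → ℝ} {N : E n → E n} {p : E n}

theorem LocalDefining.exists_abs_inner_le (h : LocalDefining Ω U ρ N) (hΩ : IsOpen Ω) (hp : p ∈ U) :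
    ∃ C : ℝ, ∃ V ∈ 𝓝 p, ∀ x ∈ V ∩ frontier Ω, ∀ y ∈ V ∩ frontier Ω,
      |⟪outwardNormal Ω x, y - x⟫| ≤ C * ‖y - x‖ ^ 2 := by
  have hd : ContDiffAt ℝ 1 (fderiv ℝ ρ) p := (h.contDiffAt hp).fderiv_right (by norm_num)
  obtain ⟨K, s, hs, hK⟩ := hd.exists_lipschitzOnWith
  have hnorm : ∀ᶠ x in 𝓝 p, ‖fderiv ℝ ρ p‖ / 2 < ‖fderiv ℝ ρ x‖ :=
    hd.continuousAt.norm.eventually (lt_mem_nhds (half_lt_self (h.norm_fderiv_pos hp)))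
  obtain ⟨r, hr, hball⟩ := Metric.mem_nhds_iff.mp
    (inter_mem hs (inter_mem (h.isOpen.mem_nhds hp) hnorm))
  refine ⟨K / (‖fderiv ℝ ρ p‖ / 2), ball p r, ball_mem_nhds p hr, ?_⟩
  rintro x ⟨hx, hxf⟩ y ⟨hy, hyf⟩
  obtain ⟨hxs, hxU, hxn⟩ := hball hx
  obtain ⟨-, hyU, -⟩ := hball hy
  have hseg : segment ℝ x y ⊆ ball p r := (convex_ball p r).segment_subset hx hy
  -- Mean value inequality for `ρ` against its linearization at `x`: `dρ` is `K`-Lipschitz, so it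
  -- varies by at most `K ‖y - x‖` on the segment. Since `ρ` vanishes at both ends, this bounds
  -- `dρ_x (y - x)` itself.
  have h1 := (convex_segment x y).norm_image_sub_le_of_norm_fderiv_le' (f := ρ)
    (φ := fderiv ℝ ρ x) (C := K * ‖y - x‖) (fun z hz => (h.hasFDerivAt
      (hball (hseg hz)).2.1).differentiableAt) (fun z hz => by
        refine (hK.norm_sub_le (hball (hseg hz)).1 hxs).trans ?_
        have := norm_sub_le_of_mem_segment hz
        rw [norm_sub_rev y x]
        rw [norm_sub_rev y x] at this
        gcongr) (left_mem_segment ℝ x y) (right_mem_segment ℝ x y)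
  rw [(h.mem_frontier_iff hΩ hxU).mp hxf, (h.mem_frontier_iff hΩ hyU).mp hyf, sub_zero, zero_sub,
    norm_neg, h.fderiv_apply x hxU, norm_mul, norm_norm, Real.norm_eq_abs] at h1
  rw [h.outwardNormal_eq hΩ hxU hxf, div_mul_eq_mul_div, le_div_iff₀ (half_pos
    (h.norm_fderiv_pos hp))]
  calc |⟪N x, y - x⟫| * (‖fderiv ℝ ρ p‖ / 2) ≤ |⟪N x, y - x⟫| * ‖fderiv ℝ ρ x‖ := by
        gcongr; exact le_of_lt hxn
    _ ≤ K * ‖y - x‖ * ‖y - x‖ := by rw [mul_comm]; exact h1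
    _ = K * ‖y - x‖ ^ 2 := by ring

/-- A preconnected set meeting both `t` and its complement meets the frontier of `t`. -/
theorem inter_frontier_nonempty_of_isPreconnected {X : Type*} [TopologicalSpace X] {s t : Set X}
    (hs : IsPreconnected s) (h1 : (s ∩ t).Nonempty) (h2 : (s ∩ tᶜ).Nonempty) :
    (s ∩ frontier t).Nonempty := by
  by_contra hne
  have hdis : ∀ x ∈ s, x ∉ frontier t := fun x hx hf => hne ⟨x, hx, hf⟩
  obtain ⟨x, hx, hxt⟩ := h1
  obtain ⟨y, hy, hyt⟩ := h2
  have hcov : s ⊆ interior t ∪ (closure t)ᶜ := fun z hz => by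
    by_cases hzi : z ∈ interior t
    · exact Or.inl hzi
    · exact Or.inr fun hzc => hdis z hz ⟨hzc, hzi⟩
  obtain ⟨z, -, hz1, hz2⟩ := hs _ _ isOpen_interior isClosed_closure.isOpen_compl hcov
    ⟨x, hx, (hcov hx).resolve_right fun h => h (subset_closure hxt)⟩
    ⟨y, hy, (hcov hy).resolve_left fun h => hyt (interior_subset h)⟩
  exact hz2 (subset_closure (interior_subset hz1))

namespace IsBoundedC2Domain

theorem isCompact_closure (hΩ : IsBoundedC2Domain Ω) : IsCompact (closure Ω) :=
  hΩ.isBounded.isCompact_closure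

theorem isCompact_frontier (hΩ : IsBoundedC2Domain Ω) : IsCompact (frontier Ω) :=
  hΩ.isCompact_closure.of_isClosed_subset isClosed_frontier frontier_subset_closure

theorem norm_outwardNormal (hΩ : IsBoundedC2Domain Ω) (hp : p ∈ frontier Ω) :
    ‖outwardNormal Ω p‖ = 1 := by
  obtain ⟨U, ρ, N, hpU, h⟩ := hΩ.exists_localDefining hp
  rw [h.outwardNormal_eq hΩ.isOpen hpU hp, h.norm_normal p hpU]

theorem continuousOn_outwardNormal (hΩ : IsBoundedC2Domain Ω) :
    ContinuousOn (outwardNormal Ω) (frontier Ω) := by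
  intro p hp
  obtain ⟨U, ρ, N, hpU, h⟩ := hΩ.exists_localDefining hp
  refine ((h.contDiffAt_normal hpU).continuousAt.continuousWithinAt).congr_of_eventuallyEq ?_
    (h.outwardNormal_eq hΩ.isOpen hpU hp)
  filter_upwards [self_mem_nhdsWithin, mem_nhdsWithin_of_mem_nhds (h.isOpen.mem_nhds hpU)]
    with x hx hxU
  exact h.outwardNormal_eq hΩ.isOpen hxU hx

/-- A `C²` hypersurface separates from its tangent planes at most quadratically, uniformly. -/
theorem exists_abs_inner_le (hΩ : IsBoundedC2Domain Ω) :
    ∃ C : ℝ, 0 ≤ C ∧ ∀ p ∈ frontier Ω, ∀ q ∈ frontier Ω,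
      |⟪outwardNormal Ω p, q - p⟫| ≤ C * ‖q - p‖ ^ 2 := by
  have key : ∃ C : ℝ, 0 ≤ C ∧ ∀ z ∈ frontier Ω ×ˢ frontier Ω, z.1 ∈ frontier Ω →
      z.2 ∈ frontier Ω → |⟪outwardNormal Ω z.1, z.2 - z.1⟫| ≤ C * ‖z.2 - z.1‖ ^ 2 := by
    refine (hΩ.isCompact_frontier.prod hΩ.isCompact_frontier).induction_on
      (p := fun s : Set (E n × E n) => ∃ C : ℝ, 0 ≤ C ∧ ∀ z ∈ s, z.1 ∈ frontier Ω →
        z.2 ∈ frontier Ω → |⟪outwardNormal Ω z.1, z.2 - z.1⟫| ≤ C * ‖z.2 - z.1‖ ^ 2)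
      ⟨0, le_rfl, by simp⟩ ?_ ?_ ?_
    · rintro s t hst ⟨C, hC, h⟩
      exact ⟨C, hC, fun z hz => h z (hst hz)⟩
    · rintro s t ⟨C, hC, h⟩ ⟨D, hD, h'⟩
      refine ⟨C + D, by positivity, ?_⟩
      rintro z (hz | hz) h1 h2
      · refine (h z hz h1 h2).trans ?_
        gcongr
        linarith
      · refine (h' z hz h1 h2).trans ?_
        gcongr
        linarith
    · rintro ⟨p, q⟩ ⟨hp, hq⟩
      simp only at hp hq
      rcases eq_or_ne p q with rfl | hne
      · obtain ⟨U, ρ, N, hpU, h⟩ := hΩ.exists_localDefining hp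
        obtain ⟨C, V, hV, hC⟩ := h.exists_abs_inner_le hΩ.isOpen hpU
        refine ⟨V ×ˢ V, mem_nhdsWithin_of_mem_nhds (prod_mem_nhds hV hV), |C|, abs_nonneg C, ?_⟩
        rintro ⟨x, y⟩ ⟨hx, hy⟩ hxf hyf
        refine (hC x ⟨hx, hxf⟩ y ⟨hy, hyf⟩).trans ?_
        gcongr
        exact le_abs_self C
      -- Off the diagonal Cauchy–Schwarz suffices, since `‖z.2 - z.1‖` stays above `‖q - p‖ / 2`.
      · have hpos : 0 < ‖q - p‖ := norm_pos_iff.mpr (sub_ne_zero.mpr hne.symm)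
        have hev : ∀ᶠ z : E n × E n in 𝓝 (p, q), ‖q - p‖ / 2 < ‖z.2 - z.1‖ := by
          have : ContinuousAt (fun z : E n × E n => ‖z.2 - z.1‖) (p, q) := by fun_prop
          exact this.eventually (lt_mem_nhds (half_lt_self hpos))
        refine ⟨_, mem_nhdsWithin_of_mem_nhds hev, (‖q - p‖ / 2)⁻¹, by positivity, ?_⟩
        intro z hz hz1 _
        have hz' : ‖q - p‖ / 2 < ‖z.2 - z.1‖ := hz
        refine (abs_real_inner_le_norm _ _).trans ?_
        rw [hΩ.norm_outwardNormal hz1, one_mul, inv_mul_eq_div, le_div_iff₀ (by positivity), sq]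
        gcongr
  obtain ⟨C, hC, h⟩ := key
  exact ⟨C, hC, fun p hp q hq => h (p, q) ⟨hp, hq⟩ hp hq⟩

/-- A point outside the closed domain lies on the outward normal through its nearest point. -/
theorem exists_nearest (hΩ : IsBoundedC2Domain Ω) {x : E n} (hx : x ∉ closure Ω) :
    ∃ q ∈ frontier Ω, dist x q = infDist x (closure Ω) ∧
      x = q + infDist x (closure Ω) • outwardNormal Ω q := by
  obtain ⟨q, hq, hdist⟩ := hΩ.isCompact_closure.exists_infDist_eq_dist
    hΩ.isConnected.nonempty.closure x
  have hmin : ∀ y ∈ closure Ω, ‖x - q‖ ≤ ‖x - y‖ := fun y hy => by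
    rw [← dist_eq_norm, ← dist_eq_norm, ← hdist]
    exact infDist_le_dist_of_mem hy
  -- If `q` were interior, the segment from `q` to `x` would cross the frontier at a point closer to
  -- `x`.
  have hqf : q ∈ frontier Ω := by
    by_contra hqf
    have hqΩ : q ∈ Ω := by
      rw [hΩ.isOpen.frontier_eq] at hqf
      by_contra hq'
      exact hqf ⟨hq, hq'⟩
    obtain ⟨y, hy, hyf⟩ := inter_frontier_nonempty_of_isPreconnected
      (convex_segment q x).isPreconnected
      ⟨q, left_mem_segment ℝ q x, hqΩ⟩
      ⟨x, right_mem_segment ℝ q x, fun h => hx (subset_closure h)⟩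
    have h1 := dist_add_dist_of_mem_segment hy
    have h2 := hmin y (frontier_subset_closure hyf)
    rw [← dist_eq_norm, ← dist_eq_norm, dist_comm x q, dist_comm x y] at h2
    have h3 : dist q y = 0 := le_antisymm (by linarith) dist_nonneg
    rw [← dist_eq_zero.mp h3] at hyf
    exact hqf hyf
  obtain ⟨U, ρ, N, hqU, h⟩ := hΩ.exists_localDefining hqf
  have h0 := (h.mem_frontier_iff hΩ.isOpen hqU).mp hqf
  have hN := h.norm_normal q hqU
  have hN2 : ⟪N q, N q⟫ = 1 := by rw [real_inner_self_eq_norm_sq, hN, one_pow]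
  set u := x - q with hu
  -- First-order condition: strictly inward directions `w` enter `Ω`, so minimality gives `2 ⟪u, w⟫
  -- ≤ t ‖w‖²` for small `t > 0`.
  have key : ∀ w, ⟪N q, w⟫ < 0 → ⟪u, w⟫ ≤ 0 := by
    intro w hw
    have h1 : Tendsto (fun t : ℝ => t * ‖w‖ ^ 2 / 2) (𝓝[>] 0) (𝓝 0) := by
      have : Continuous (fun t : ℝ => t * ‖w‖ ^ 2 / 2) := by fun_prop
      simpa using (this.tendsto 0).mono_left nhdsWithin_le_nhds
    refine ge_of_tendsto h1 ?_
    filter_upwards [h.eventually_neg hqU h0 hw, h.eventually_mem_line hqU w, self_mem_nhdsWithin]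
      with t ht htU ht0
    have ht0' : (0 : ℝ) < t := ht0
    have h2 := hmin _ (subset_closure ((h.mem_iff _ htU).mpr ht))
    rw [show x - (q + t • w) = u - t • w by rw [hu]; abel] at h2
    have h3 : ‖u‖ ^ 2 ≤ ‖u - t • w‖ ^ 2 := by gcongr
    rw [norm_sub_sq_real u, inner_smul_right, norm_smul, Real.norm_of_nonneg ht0'.le] at h3
    have h4 : t * (2 * ⟪u, w⟫) ≤ t * (t * ‖w‖ ^ 2) := by nlinarith
    have h5 := le_of_mul_le_mul_left h4 ht0'
    linarith
  have hc : 0 ≤ ⟪N q, u⟫ := by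
    have := key (-N q) (h.inner_neg_normal_neg hqU)
    rw [inner_neg_right, real_inner_comm] at this
    linarith
  have hcol : u = ⟪N q, u⟫ • N q := by
    set c := ⟪N q, u⟫ with hcdef
    have hc' : ⟪u, N q⟫ = c := by rw [hcdef, real_inner_comm]
    have h1 : ∀ δ : ℝ, 0 < δ → ‖u - c • N q‖ ^ 2 ≤ δ * c := by
      intro δ hδ
      -- The tangential part of `u` is not strictly inward; subtracting `δ N` makes it so, at a cost
      -- of `δ c`.
      have h2 := key (u - c • N q - δ • N q) (by
        rw [inner_sub_right, inner_sub_right, inner_smul_right, inner_smul_right, hN2, ← hcdef]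
        linarith)
      rw [inner_sub_right, inner_sub_right, inner_smul_right, inner_smul_right, hc',
        real_inner_self_eq_norm_sq] at h2
      rw [norm_sub_sq_real, inner_smul_right, hc', norm_smul, hN, Real.norm_eq_abs, mul_one, sq_abs]
      linarith
    have h2 : ‖u - c • N q‖ ^ 2 ≤ 0 := by
      refine le_of_forall_pos_le_add fun η hη => ?_
      refine (h1 (η / (c + 1)) (by positivity)).trans ?_
      rw [zero_add, div_mul_eq_mul_div, div_le_iff₀ (by positivity)]
      nlinarith
    have h3 : ‖u - c • N q‖ = 0 := by
      have := norm_nonneg (u - c • N q)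
      nlinarith
    exact sub_eq_zero.mp (norm_eq_zero.mp h3)
  have hnorm : ⟪N q, u⟫ = infDist x (closure Ω) := by
    rw [hdist, dist_eq_norm, ← hu]
    conv_rhs => rw [hcol, norm_smul, hN, mul_one, Real.norm_of_nonneg hc]
  refine ⟨q, hqf, hdist.symm, ?_⟩
  rw [h.outwardNormal_eq hΩ.isOpen hqU hqf, ← hnorm, ← hcol, hu]
  abel

end IsBoundedC2Domain

/-- The normal exponential map `(p, t) ↦ p + t ν(p)` of `∂Ω`. -/
def normalExp (Ω : Set (E n)) (z : E n × ℝ) : E n := z.1 + z.2 • outwardNormal Ω z.1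

/-! ### The outer collar as an injective image of the normal exponential map -/

namespace IsBoundedC2Domain

variable {C t : ℝ}

/-- Expanding the square leaves `t² - 2 t ⟪ν, q - p⟫ + ‖q - p‖²`, which is at least `t² + (1 - 2 C
t) ‖q - p‖²`. -/
theorem sq_lt_norm_sub_sq (hΩ : IsBoundedC2Domain Ω)
    (hC : ∀ p ∈ frontier Ω, ∀ q ∈ frontier Ω, |⟪outwardNormal Ω p, q - p⟫| ≤ C * ‖q - p‖ ^ 2)
    (ht : 0 ≤ t) (htC : 2 * C * t < 1) (hp : p ∈ frontier Ω) {q : E n} (hq : q ∈ frontier Ω)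
    (hne : q ≠ p) : t ^ 2 < ‖normalExp Ω (p, t) - q‖ ^ 2 := by
  have h1 : normalExp Ω (p, t) - q = t • outwardNormal Ω p - (q - p) := by
    simp only [normalExp]; abel
  rw [h1, norm_sub_sq_real, inner_smul_left, norm_smul, hΩ.norm_outwardNormal hp, mul_one,
    Real.norm_of_nonneg ht]
  have h2 := (abs_le.mp (hC p hp q hq)).2
  have h3 : 0 < ‖q - p‖ ^ 2 := by
    have := norm_pos_iff.mpr (sub_ne_zero.mpr hne)
    positivity
  have h4 : t * ⟪outwardNormal Ω p, q - p⟫ ≤ t * (C * ‖q - p‖ ^ 2) := by gcongr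
  simp only [conj_trivial]
  nlinarith

/-- The normal ray starts outside the closure, so a return would cross the frontier at some
parameter `r > 0`. Taking that crossing point as `q` in `sq_lt_norm_sub_sq` gives `r² < 0`. -/
theorem normalExp_notMem_closure (hΩ : IsBoundedC2Domain Ω)
    (hC : ∀ p ∈ frontier Ω, ∀ q ∈ frontier Ω, |⟪outwardNormal Ω p, q - p⟫| ≤ C * ‖q - p‖ ^ 2)
    (hC0 : 0 ≤ C) (ht : 0 < t) (htC : 2 * C * t < 1) (hp : p ∈ frontier Ω) :
    normalExp Ω (p, t) ∉ closure Ω := by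
  intro hcl
  obtain ⟨U, ρ, N, hpU, h⟩ := hΩ.exists_localDefining hp
  have hout := ((h.isOutwardUnitNormal_iff hΩ.isOpen hpU hp _).mpr
    (h.outwardNormal_eq hΩ.isOpen hpU hp)).2.2
  obtain ⟨s, hs, hs0, hst⟩ := (hout.and (Ioo_mem_nhdsGT ht)).exists
  have hconn : IsPreconnected ((fun r : ℝ => normalExp Ω (p, r)) '' Icc s t) := by
    refine isPreconnected_Icc.image _ (Continuous.continuousOn ?_)
    change Continuous fun r : ℝ => p + r • outwardNormal Ω p
    fun_prop
  obtain ⟨_, ⟨r, hr, rfl⟩, hrf⟩ := inter_frontier_nonempty_of_isPreconnected hconn (t := closure Ω)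
    ⟨_, ⟨t, right_mem_Icc.mpr hst.le, rfl⟩, hcl⟩ ⟨_, ⟨s, left_mem_Icc.mpr hst.le, rfl⟩, hs⟩
  have hrf' : normalExp Ω (p, r) ∈ frontier Ω := frontier_closure_subset hrf
  have hr0 : 0 < r := hs0.trans_le hr.1
  have hne : normalExp Ω (p, r) ≠ p := by
    intro heq
    have h1 : r • outwardNormal Ω p = 0 := by simpa [normalExp] using heq
    have h2 := congrArg norm h1
    rw [norm_smul, hΩ.norm_outwardNormal hp] at h2
    simp [hr0.ne'] at h2
  have hrC : 2 * C * r < 1 := lt_of_le_of_lt (by have := hr.2; gcongr) htC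
  have := hΩ.sq_lt_norm_sub_sq hC hr0.le hrC hp hrf' hne
  simp only [sub_self, norm_zero] at this
  nlinarith

theorem nearest_normalExp (hΩ : IsBoundedC2Domain Ω)
    (hC : ∀ p ∈ frontier Ω, ∀ q ∈ frontier Ω, |⟪outwardNormal Ω p, q - p⟫| ≤ C * ‖q - p‖ ^ 2)
    (hC0 : 0 ≤ C) (ht : 0 < t) (htC : 2 * C * t < 1) (hp : p ∈ frontier Ω) :
    infDist (normalExp Ω (p, t)) (closure Ω) = t ∧
      ∀ q ∈ frontier Ω, dist (normalExp Ω (p, t)) q = t → q = p := by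
  have hdp : dist (normalExp Ω (p, t)) p = t := by
    simp [normalExp, norm_smul, hΩ.norm_outwardNormal hp, ht.le]
  have hlt : ∀ q ∈ frontier Ω, dist (normalExp Ω (p, t)) q ≤ t → q = p := by
    intro q hq hd
    by_contra hne
    have h1 := hΩ.sq_lt_norm_sub_sq hC ht.le htC hp hq hne
    rw [← dist_eq_norm] at h1
    exact absurd (lt_of_pow_lt_pow_left₀ 2 dist_nonneg h1) (not_lt.mpr hd)
  obtain ⟨q, hq, hd, -⟩ := hΩ.exists_nearest (hΩ.normalExp_notMem_closure hC hC0 ht htC hp)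
  have hle : infDist (normalExp Ω (p, t)) (closure Ω) ≤ t :=
    (infDist_le_dist_of_mem (frontier_subset_closure hp)).trans hdp.le
  have hqp := hlt q hq (hd.trans_le hle)
  subst hqp
  exact ⟨hd.symm.trans hdp, fun q hq hd => hlt q hq hd.le⟩

/-- The image point determines `t` as its distance to `closure Ω`, and then `p` as its unique
nearest boundary point. -/
theorem injOn_normalExp (hΩ : IsBoundedC2Domain Ω)
    (hC : ∀ p ∈ frontier Ω, ∀ q ∈ frontier Ω, |⟪outwardNormal Ω p, q - p⟫| ≤ C * ‖q - p‖ ^ 2)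
    (hC0 : 0 ≤ C) {ε : ℝ} (hε : 2 * C * ε < 1) :
    InjOn (normalExp Ω) (frontier Ω ×ˢ Ioc 0 ε) := by
  rintro ⟨p, t⟩ ⟨hp, ht⟩ ⟨q, s⟩ ⟨hq, hs⟩ heq
  simp only at hp ht hq hs
  have htC : 2 * C * t < 1 := lt_of_le_of_lt (by have := ht.2; gcongr) hε
  have hsC : 2 * C * s < 1 := lt_of_le_of_lt (by have := hs.2; gcongr) hε
  have h1 := hΩ.nearest_normalExp hC hC0 ht.1 htC hp
  have h2 := hΩ.nearest_normalExp hC hC0 hs.1 hsC hq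
  rw [← heq] at h2
  have hts : t = s := h1.1.symm.trans h2.1
  subst hts
  have h3 : dist (normalExp Ω (p, t)) p = t := by
    simp [normalExp, norm_smul, hΩ.norm_outwardNormal hp, ht.1.le]
  rw [h2.2 p hp h3]

theorem parallelBody_diff_closure (hΩ : IsBoundedC2Domain Ω)
    (hC : ∀ p ∈ frontier Ω, ∀ q ∈ frontier Ω, |⟪outwardNormal Ω p, q - p⟫| ≤ C * ‖q - p‖ ^ 2)
    (hC0 : 0 ≤ C) {ε : ℝ} (hε : 2 * C * ε < 1) :
    parallelBody (closure Ω) ε \ closure Ω = normalExp Ω '' (frontier Ω ×ˢ Ioc 0 ε) := by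
  ext x
  constructor
  · rintro ⟨hx, hxc⟩
    obtain ⟨q, hq, hd, hxq⟩ := hΩ.exists_nearest hxc
    refine ⟨(q, infDist x (closure Ω)), ⟨hq, ?_, hx⟩, hxq.symm⟩
    exact (isClosed_closure.notMem_iff_infDist_pos hΩ.isConnected.nonempty.closure).mp hxc
  · rintro ⟨⟨p, t⟩, ⟨hp, ht⟩, rfl⟩
    have htC : 2 * C * t < 1 := lt_of_le_of_lt (by have := ht.2; gcongr) hε
    exact ⟨(hΩ.nearest_normalExp hC hC0 ht.1 htC hp).1.trans_le ht.2,
      hΩ.normalExp_notMem_closure hC hC0 ht.1 htC hp⟩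

theorem continuousOn_normalExp (hΩ : IsBoundedC2Domain Ω) (s : Set ℝ) :
    ContinuousOn (normalExp Ω) (frontier Ω ×ˢ s) :=
  continuousOn_fst.add (continuousOn_snd.smul
    (hΩ.continuousOn_outwardNormal.comp continuousOn_fst fun _ hz => hz.1))

end IsBoundedC2Domain

end

/-! ### Coordinates adapted to a tangent hyperplane, and the tube map -/

section

theorem _root_.LipschitzOnWith.euclideanHausdorffMeasure_image_le {X Y : Type*} [EMetricSpace X]
    [MeasurableSpace X] [BorelSpace X] [EMetricSpace Y] [MeasurableSpace Y] [BorelSpace Y]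
    {f : X → Y} {s : Set X} {K : ℝ≥0} (h : LipschitzOnWith K f s) (d : ℕ) :
    Measure.euclideanHausdorffMeasure d (f '' s) ≤
      (K : ℝ≥0∞) ^ d * Measure.euclideanHausdorffMeasure d s := by
  rw [Measure.euclideanHausdorffMeasure_def, Measure.euclideanHausdorffMeasure_def,
    Measure.smul_apply, Measure.smul_apply, mul_smul_comm]
  have := h.hausdorffMeasure_image_le (d := (d : ℝ)) (Nat.cast_nonneg d)
  rw [ENNReal.rpow_natCast] at this
  gcongr

variable {n : ℕ} {Ω U : Set (E n)} {ρ : E n → ℝ} {N φ H : E n → E n} {p ν : E n}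

/-- The hyperplane orthogonal to `ν`. -/
abbrev perp (ν : E n) : Submodule ℝ (E n) := (Submodule.span ℝ {ν})ᗮ

theorem finrank_perp (hν : ‖ν‖ = 1) : finrank ℝ (perp ν) = n := by
  have : Fact (finrank ℝ (E n) = n + 1) := ⟨by simp⟩
  exact Submodule.finrank_orthogonal_span_singleton (by
    rw [← norm_ne_zero_iff, hν]; exact one_ne_zero)

theorem euclideanHausdorffMeasure_perp (hν : ‖ν‖ = 1) :
    (Measure.euclideanHausdorffMeasure n : Measure (perp ν)) = volume := by
  have := InnerProductSpace.euclideanHausdorffMeasure_eq_volume (V := perp ν)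
  rwa [finrank_perp hν] at this

/-- The orthonormal coordinates `(y, t) ↦ p + y + t ν` of Euclidean space, with `y` in the hyperplane
orthogonal to `ν`. -/
def perpProdEquiv (p : E n) (hν : ‖ν‖ = 1) : perp ν × ℝ ≃ᵐ E n :=
  MeasurableEquiv.prodComm.trans <|
    (MeasurableEquiv.prodCongr
      (LinearIsometryEquiv.toSpanUnitSingleton ν hν).toHomeomorph.toMeasurableEquiv
      (MeasurableEquiv.refl _)).trans ((Submodule.span ℝ {ν}).measurableEquivProd p).symm

theorem perpProdEquiv_apply (p : E n) (hν : ‖ν‖ = 1) (z : perp ν × ℝ) :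
    perpProdEquiv p hν z = z.2 • ν + z.1 + p := by
  simp only [perpProdEquiv, MeasurableEquiv.trans_apply, Submodule.measurableEquivProd_symm_apply,
    vadd_eq_add]
  rfl

theorem measurePreserving_perpProdEquiv (p : E n) (hν : ‖ν‖ = 1) :
    MeasurePreserving (perpProdEquiv p hν) := by
  have h1 := ((Submodule.span ℝ {ν}).measurePreserving_measurableEquivProd p).symm
  rw [InnerProductSpace.euclideanHausdorffMeasure_eq_volume] at h1
  have h2 := (LinearIsometryEquiv.toSpanUnitSingleton ν hν).measurePreserving
  exact h1.comp ((h2.prod (MeasurePreserving.id (volume : Measure (perp ν)))).comp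
    Measure.measurePreserving_swap)

/-- The affine projection to the hyperplane through `p` orthogonal to `ν`. -/
def affineProj (p ν z : E n) : E n := p + projAlong ν (z - p)

/-- The map which is `x + t ν ↦ φ(x) + t N(φ(x))` on the affine hyperplane through `p` orthogonal to
`ν`. -/
def tubeMap (p ν : E n) (φ N : E n → E n) (z : E n) : E n :=
  φ (affineProj p ν z) + ⟪ν, z - p⟫ • N (φ (affineProj p ν z))

/-- The derivative of `tubeMap`. -/
def tubeDeriv (ν : E n) (φ N : E n → E n) (w : E n × ℝ) : E n →L[ℝ] E n :=
  fderiv ℝ φ w.1 ∘L projAlong ν +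
    (w.2 • (fderiv ℝ N (φ w.1) ∘L (fderiv ℝ φ w.1 ∘L projAlong ν)) +
      (innerSL ℝ ν).smulRight (N (φ w.1)))

theorem projAlong_of_mem_perp (y : perp ν) : projAlong ν (y : E n) = y := by
  rw [projAlong_apply, Submodule.mem_orthogonal_singleton_iff_inner_right.mp y.2]
  simp

theorem projAlong_self (hν : ‖ν‖ = 1) : projAlong ν ν = 0 := by
  rw [projAlong_apply, real_inner_self_eq_norm_sq, hν]
  simp

theorem affineProj_perpProdEquiv (hν : ‖ν‖ = 1) (z : perp ν × ℝ) :
    affineProj p ν (perpProdEquiv p hν z) = p + z.1 := by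
  rw [affineProj, perpProdEquiv_apply, add_sub_cancel_right, map_add, map_smul,
    projAlong_self hν, projAlong_of_mem_perp, smul_zero, zero_add]

theorem inner_perpProdEquiv (hν : ‖ν‖ = 1) (z : perp ν × ℝ) :
    ⟪ν, perpProdEquiv p hν z - p⟫ = z.2 := by
  rw [perpProdEquiv_apply, add_sub_cancel_right, inner_add_right, inner_smul_right,
    real_inner_self_eq_norm_sq, hν, Submodule.mem_orthogonal_singleton_iff_inner_right.mp z.1.2]
  simp

theorem hasFDerivAt_tubeMap {z : E n} (hφ : DifferentiableAt ℝ φ (affineProj p ν z))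
    (hN : DifferentiableAt ℝ N (φ (affineProj p ν z))) :
    HasFDerivAt (tubeMap p ν φ N) (tubeDeriv ν φ N (affineProj p ν z, ⟪ν, z - p⟫)) z := by
  have h1 : HasFDerivAt (affineProj p ν) (projAlong ν) z :=
    ((projAlong ν).hasFDerivAt.comp z ((hasFDerivAt_id z).sub_const p)).const_add p
  have h2 := hφ.hasFDerivAt.comp z h1
  have h3 := hN.hasFDerivAt.comp z h2
  have h4 : HasFDerivAt (fun x : E n => ⟪ν, x - p⟫) (innerSL ℝ ν) z :=
    (innerSL ℝ ν).hasFDerivAt.comp z ((hasFDerivAt_id z).sub_const p)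
  exact h2.add (h4.smul h3)

/-- The coordinate of `∂Ω` near `p` in the hyperplane orthogonal to `ν`. -/
def flatCoord (p ν : E n) (H : E n → E n) (x : E n) : perp ν :=
  (perp ν).orthogonalProjectionOnto (H x - p)

theorem LipschitzOnWith.flatCoord {K : ℝ≥0} {s : Set (E n)} (h : LipschitzOnWith K H s) :
    LipschitzOnWith K (flatCoord p ν H) s := by
  refine LipschitzOnWith.of_dist_le_mul fun x hx y hy => ?_
  rw [dist_eq_norm, SteinerFormula.flatCoord, SteinerFormula.flatCoord, ← map_sub,
    sub_sub_sub_cancel_right]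
  refine (Submodule.norm_orthogonalProjectionOnto_apply_le _ _).trans ?_
  rw [← dist_eq_norm]
  exact h.dist_le_mul x hx y hy

theorem add_flatCoord {x : E n} (hν : ‖ν‖ = 1) (hx : ⟪ν, H x - p⟫ = 0) :
    p + (flatCoord p ν H x : E n) = H x := by
  rw [flatCoord, ← projAlong_eq_orthogonalProjectionOnto hν, projAlong_apply, hx]
  simp

end

/-! ### Local volume of the tube in flat coordinates -/

section

variable {n : ℕ} {Ω U : Set (E n)} {ρ : E n → ℝ} {N φ H : E n → E n} {p ν : E n}

namespace FlatteningChart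

theorem tendsto_map (hc : FlatteningChart Ω p ν φ H) : Tendsto H (𝓝 p) (𝓝 p) := by
  simpa [ContinuousAt, hc.map_base] using hc.hasStrictFDerivAt.continuousAt

/-- Near `p`, the chart distorts `n`-dimensional measure by a factor close to `1`. -/
theorem measure_flatCoord_image (hc : FlatteningChart Ω p ν φ H) (hν : ‖ν‖ = 1) {K : ℝ≥0}
    (hK : 1 < K) :
    ∃ V ∈ 𝓝 p, ContinuousOn (flatCoord p ν H) V ∧ InjOn (flatCoord p ν H) (V ∩ frontier Ω) ∧
      ∀ B ⊆ V ∩ frontier Ω,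
        volume (flatCoord p ν H '' B) < ∞ ∧
        volume (flatCoord p ν H '' B) ≤ (K : ℝ≥0∞) ^ n * Measure.euclideanHausdorffMeasure n B ∧
        Measure.euclideanHausdorffMeasure n B ≤ (K : ℝ≥0∞) ^ n * volume (flatCoord p ν H '' B) := by
  have hid : ‖ContinuousLinearMap.id ℝ (E n)‖₊ < K :=
    lt_of_le_of_lt (by exact_mod_cast ContinuousLinearMap.norm_id_le) hK
  obtain ⟨s, hs, hsK⟩ := hc.hasStrictFDerivAt.exists_lipschitzOnWith_of_nnnorm_lt K hid
  have hφs := hc.contDiffAt_symm.hasStrictFDerivAt' hc.hasFDerivAt_symm one_ne_zero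
  obtain ⟨r, hr, hrK⟩ := hφs.exists_lipschitzOnWith_of_nnnorm_lt K hid
  let V : Set (E n) := {x | x ∈ s ∧ H x ∈ r ∧ H x ∈ ball p 1 ∧ φ (H x) = x ∧
    (x ∈ frontier Ω ↔ ⟪ν, H x - p⟫ = 0)}
  have hV : V ∈ 𝓝 p := by
    filter_upwards [hs, hc.tendsto_map hr, hc.tendsto_map (ball_mem_nhds p one_pos), hc.left_inv,
      hc.mem_frontier_iff] with x h1 h2 h3 h4 h5
    exact ⟨h1, h2, h3, h4, h5⟩
  have hadd : ∀ x ∈ V ∩ frontier Ω, p + (flatCoord p ν H x : E n) = H x := fun x hx =>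
    add_flatCoord hν (hx.1.2.2.2.2.mp hx.2)
  have hlip : LipschitzOnWith K (flatCoord p ν H) V :=
    (LipschitzOnWith.flatCoord hsK).mono fun x hx => hx.1
  refine ⟨V, hV, hlip.continuousOn, ?_, ?_⟩
  · intro x hx y hy hxy
    have h1 : H x = H y := by rw [← hadd x hx, ← hadd y hy, hxy]
    rw [← hx.1.2.2.2.1, ← hy.1.2.2.2.1, h1]
  · intro B hB
    have hsub : flatCoord p ν H '' B ⊆ ball 0 1 := by
      rintro _ ⟨x, hx, rfl⟩
      have h1 := (hB hx).1.2.2.1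
      rw [← hadd x (hB hx)] at h1
      simpa using h1
    refine ⟨(measure_mono hsub).trans_lt measure_ball_lt_top, ?_, ?_⟩
    · rw [← euclideanHausdorffMeasure_perp hν]
      exact (hlip.mono fun x hx => (hB hx).1).euclideanHausdorffMeasure_image_le n
    · rw [← euclideanHausdorffMeasure_perp hν]
      -- The reverse estimate uses the inverse parametrization `y ↦ φ (p + y)`, which is also
      -- `K`-Lipschitz and recovers `B`.
      have hlip2 : LipschitzOnWith K (fun y : perp ν => φ (p + y)) (flatCoord p ν H '' B) := by
        refine LipschitzOnWith.of_dist_le_mul ?_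
        rintro _ ⟨x, hx, rfl⟩ _ ⟨y, hy, rfl⟩
        have h1 := hrK.dist_le_mul _ (hB hx).1.2.1 _ (hB hy).1.2.1
        rw [hadd x (hB hx), hadd y (hB hy)]
        refine h1.trans (le_of_eq ?_)
        rw [← hadd x (hB hx), ← hadd y (hB hy), dist_add_left, Subtype.dist_eq]
      have h2 : B = (fun y : perp ν => φ (p + y)) '' (flatCoord p ν H '' B) := by
        ext x
        constructor
        · intro hx
          exact ⟨_, ⟨x, hx, rfl⟩, by simp only; rw [hadd x (hB hx), (hB hx).1.2.2.2.1]⟩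
        · rintro ⟨_, ⟨y, hy, rfl⟩, rfl⟩
          simp only
          rwa [hadd y (hB hy), (hB hy).1.2.2.2.1]
      conv_lhs => rw [h2]
      exact hlip2.euclideanHausdorffMeasure_image_le n

end FlatteningChart

namespace LocalDefining

/-- At the base point `dφ` is the identity, and the projection along `N p` plus the rank-one normal
term adds up to the identity. -/
theorem tubeDeriv_base (hc : FlatteningChart Ω p (N p) φ H) (t : ℝ) :
    tubeDeriv (N p) φ N (p, t) =
      ContinuousLinearMap.id ℝ (E n) + t • (fderiv ℝ N p ∘L projAlong (N p)) := by
  ext1 v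
  simp only [tubeDeriv, hc.symm_base, hc.hasFDerivAt_symm.fderiv]
  simp [projAlong_apply]

theorem continuousAt_tubeDeriv (h : LocalDefining Ω U ρ N) (hp : p ∈ U)
    (hc : FlatteningChart Ω p (N p) φ H) (t : ℝ) :
    ContinuousAt (tubeDeriv (N p) φ N) (p, t) := by
  have h1 : ContinuousAt (fun w : E n × ℝ => fderiv ℝ φ w.1) (p, t) :=
    ((hc.contDiffAt_symm.fderiv_right (m := 0) (by norm_num)).continuousAt).comp
      (x := (p, t)) continuousAt_fst
  have h2 : ContinuousAt (fun w : E n × ℝ => φ w.1) (p, t) :=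
    hc.contDiffAt_symm.continuousAt.comp (x := (p, t)) continuousAt_fst
  have h3 : ContinuousAt (fun w : E n × ℝ => N (φ w.1)) (p, t) :=
    ContinuousAt.comp_of_eq (g := N) (y := p) (h.contDiffAt_normal hp).continuousAt h2 hc.symm_base
  have h4 : ContinuousAt (fun w : E n × ℝ => fderiv ℝ N (φ w.1)) (p, t) :=
    ContinuousAt.comp_of_eq (g := fderiv ℝ N) (y := p)
      (h.continuousOn_fderiv_normal.continuousAt (h.isOpen.mem_nhds hp)) h2 hc.symm_base
  have h5 : ContinuousAt (fun w : E n × ℝ => fderiv ℝ φ w.1 ∘L projAlong (N p)) (p, t) :=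
    h1.clm_comp continuousAt_const
  have h6 : ContinuousAt (fun w : E n × ℝ => (innerSL ℝ (N p)).smulRight (N (φ w.1))) (p, t) := by
    have : Continuous (fun v : E n => (innerSL ℝ (N p)).smulRight v) := by fun_prop
    exact this.continuousAt.comp h3
  exact h5.add ((continuousAt_snd.smul (h4.clm_comp h5)).add h6)

/-- Near `p`, the part of the tube over a piece `B` of `∂Ω` has volume close to the measure of `B`
in flat coordinates times the integral of `det (1 + t A_p)`. -/
theorem exists_tube_volume_flat (h : LocalDefining Ω U ρ N) (hΩ : IsOpen Ω) (hp : p ∈ U)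
    (hc : FlatteningChart Ω p (N p) φ H)
    {ε : ℝ} (hε : 0 ≤ ε) (hinj : InjOn (normalExp Ω) (frontier Ω ×ˢ Ioc 0 ε)) {η : ℝ}
    (hη : 0 < η) :
    ∃ V ∈ 𝓝 p, ∀ B ⊆ V ∩ frontier Ω, MeasurableSet (flatCoord p (N p) H '' B) →
      volume (flatCoord p (N p) H '' B) < ∞ →
      |volume.real (normalExp Ω '' (B ×ˢ Ioc 0 ε)) - volume.real (flatCoord p (N p) H '' B) *
        (∫ t in Ioc 0 ε, |(ContinuousLinearMap.id ℝ (E n) +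
          t • (fderiv ℝ N p ∘L projAlong (N p))).det|)| ≤
        η * (volume.real (flatCoord p (N p) H '' B) * ε) := by
  have hν := h.norm_normal p hp
  have hdet : ∀ᶠ q in 𝓝 p, ∀ t ∈ Icc 0 ε, |(|(tubeDeriv (N p) φ N (q, t)).det| -
      |(tubeDeriv (N p) φ N (p, t)).det|)| < η := by
    -- Compactness of `[0, ε]` makes the neighbourhood of `p` independent of `t`.
    refine isCompact_Icc.eventually_forall_of_forall_eventually fun t _ => ?_
    have h1 := (ContinuousLinearMap.continuous_det.continuousAt.comp
      (h.continuousAt_tubeDeriv hp hc t)).abs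
    have h2 : ContinuousAt (fun w : E n × ℝ => (tubeDeriv (N p) φ N (p, w.2)).det) (p, t) :=
      ContinuousLinearMap.continuous_det.continuousAt.comp
        (by
          have : Continuous fun w : E n × ℝ => tubeDeriv (N p) φ N (p, w.2) := by
            simp_rw [tubeDeriv_base hc]
            fun_prop
          exact this.continuousAt)
    have h3 := (h1.sub h2.abs).abs
    refine h3.eventually (gt_mem_nhds ?_)
    simpa using hη
  let V : Set (E n) := {x | (∀ t ∈ Icc 0 ε, |(|(tubeDeriv (N p) φ N (H x, t)).det| -
      |(tubeDeriv (N p) φ N (p, t)).det|)| < η) ∧ DifferentiableAt ℝ φ (H x) ∧ φ (H x) = x ∧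
      x ∈ U ∧ (x ∈ frontier Ω ↔ ⟪N p, H x - p⟫ = 0)}
  have hV : V ∈ 𝓝 p := by
    have hφd : ∀ᶠ z in 𝓝 p, DifferentiableAt ℝ φ z :=
      (hc.contDiffAt_symm.eventually (by simp)).mono fun z hz => hz.differentiableAt one_ne_zero
    filter_upwards [hc.tendsto_map.eventually hdet, hc.tendsto_map.eventually hφd, hc.left_inv,
      h.isOpen.mem_nhds hp, hc.mem_frontier_iff] with x h1 h2 h3 h4 h5
    exact ⟨h1, h2, h3, h4, h5⟩
  refine ⟨V, hV, fun B hB hmeas hfin => ?_⟩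
  have hadd : ∀ x ∈ B, p + (flatCoord p (N p) H x : E n) = H x := fun x hx =>
    add_flatCoord hν ((hB hx).1.2.2.2.2.mp (hB hx).2)
  set Y := flatCoord p (N p) H '' B with hY
  set e := perpProdEquiv p hν with he
  have hmp : MeasurePreserving e := measurePreserving_perpProdEquiv p hν
  set Z := e '' (Y ×ˢ Ioc 0 ε) with hZ
  have hZm : MeasurableSet Z := e.measurableEmbedding.measurableSet_image.mpr
    (hmeas.prod measurableSet_Ioc)
  have hproj : ∀ x ∈ B, ∀ t, affineProj p (N p) (e (flatCoord p (N p) H x, t)) = H x := fun x hx t => by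
    rw [he, affineProj_perpProdEquiv hν, hadd x hx]
  have hinner : ∀ z, ⟪N p, e z - p⟫ = z.2 := fun z => inner_perpProdEquiv hν z
  have htube : ∀ x ∈ B, ∀ t, tubeMap p (N p) φ N (e (flatCoord p (N p) H x, t)) =
      normalExp Ω (x, t) := fun x hx t => by
    rw [tubeMap, hproj x hx, hinner, (hB hx).1.2.2.1, normalExp,
      h.outwardNormal_eq hΩ (hB hx).1.2.2.2.1 (hB hx).2]
  have himg : normalExp Ω '' (B ×ˢ Ioc 0 ε) = tubeMap p (N p) φ N '' Z := by
    ext v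
    constructor
    · rintro ⟨⟨x, t⟩, ⟨hx, ht⟩, rfl⟩
      exact ⟨_, ⟨(flatCoord p (N p) H x, t), ⟨⟨x, hx, rfl⟩, ht⟩, rfl⟩, htube x hx t⟩
    · rintro ⟨_, ⟨⟨_, t⟩, ⟨⟨x, hx, rfl⟩, ht⟩, rfl⟩, rfl⟩
      exact ⟨(x, t), ⟨hx, ht⟩, (htube x hx t).symm⟩
  have hinjZ : InjOn (tubeMap p (N p) φ N) Z := by
    rintro _ ⟨⟨_, t⟩, ⟨⟨x, hx, rfl⟩, ht⟩, rfl⟩ _ ⟨⟨_, s⟩, ⟨⟨y, hy, rfl⟩, hs⟩, rfl⟩ heq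
    rw [htube x hx t, htube y hy s] at heq
    have h1 := hinj ⟨(hB hx).2, ht⟩ ⟨(hB hy).2, hs⟩ heq
    simp only [Prod.mk.injEq] at h1
    rw [h1.1, h1.2]
  let L : E n → (E n →L[ℝ] E n) := fun z => tubeDeriv (N p) φ N (affineProj p (N p) z, ⟪N p, z - p⟫)
  have hderiv : ∀ z ∈ Z, HasFDerivWithinAt (tubeMap p (N p) φ N) (L z) Z z := by
    rintro _ ⟨⟨_, t⟩, ⟨⟨x, hx, rfl⟩, ht⟩, rfl⟩
    refine (hasFDerivAt_tubeMap ?_ ?_).hasFDerivWithinAt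
    · rw [hproj x hx]
      exact (hB hx).1.2.1
    · rw [hproj x hx, (hB hx).1.2.2.1]
      exact (h.contDiffAt_normal (hB hx).1.2.2.2.1).differentiableAt one_ne_zero
  have hvolZ : volume Z = volume Y * ENNReal.ofReal ε := by
    rw [hZ, ← hmp.measure_preimage_equiv, preimage_image_eq _ e.injective, Measure.volume_eq_prod, Measure.prod_prod, Real.volume_Ioc,
      sub_zero]
  have hZfin : volume Z < ∞ := by
    rw [hvolZ]
    exact ENNReal.mul_lt_top hfin ENNReal.ofReal_lt_top
  have hZreal : volume.real Z = volume.real Y * ε := by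
    rw [Measure.real, hvolZ, ENNReal.toReal_mul, ENNReal.toReal_ofReal hε, Measure.real]
  let D : ℝ → ℝ := fun t => |(ContinuousLinearMap.id ℝ (E n) +
          t • (fderiv ℝ N p ∘L projAlong (N p))).det|
  have hDc : Continuous D := by
    refine (ContinuousLinearMap.continuous_det.comp ?_).abs
    fun_prop
  have hDeq : ∀ t, |(tubeDeriv (N p) φ N (p, t)).det| = D t := fun t => by
    rw [tubeDeriv_base hc]
  have hclose : ∀ z ∈ Z, ‖|(L z).det| - D ⟪N p, z - p⟫‖ ≤ η := by
    rintro _ ⟨⟨_, t⟩, ⟨⟨x, hx, rfl⟩, ht⟩, rfl⟩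
    have h1 := (hB hx).1.1 t ⟨ht.1.le, ht.2⟩
    simp only [L]
    rw [hproj x hx, hinner, ← hDeq]
    exact h1.le
  have hDZ : ∫ z in Z, D ⟪N p, z - p⟫ = volume.real Y * ∫ t in Ioc 0 ε, D t := by
    rw [hZ, hmp.setIntegral_image_emb e.measurableEmbedding]
    simp_rw [hinner]
    have := setIntegral_prod_mul (μ := (volume : Measure (perp (N p)))) (ν := (volume : Measure ℝ))
      (fun _ => (1 : ℝ)) D Y (Ioc 0 ε)
    simpa [Measure.volume_eq_prod] using this
  have hcv : volume.real (normalExp Ω '' (B ×ˢ Ioc 0 ε)) = ∫ z in Z, |(L z).det| := by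
    have := integral_image_eq_integral_abs_det_fderiv_smul volume hZm hderiv hinjZ
      (fun _ => (1 : ℝ))
    rw [himg]
    simpa using this
  have hDint : IntegrableOn (fun z => D ⟪N p, z - p⟫) Z := by
    obtain ⟨M, hM⟩ := isCompact_Icc.exists_bound_of_continuousOn (s := Icc 0 ε) hDc.continuousOn
    refine Measure.integrableOn_of_bounded (M := M) hZfin.ne ?_ ?_
    · refine (hDc.comp ?_).aestronglyMeasurable
      fun_prop
    · refine (ae_restrict_iff' hZm).mpr (Eventually.of_forall ?_)
      rintro _ ⟨⟨y, t⟩, ⟨_, ht⟩, rfl⟩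
      rw [hinner]
      exact hM t ⟨ht.1.le, ht.2⟩
  -- Continuity of the derivative is available only at `(p, t)`; measurability on `Z` comes from `L`
  -- being a derivative of the tube map within `Z`.
  have hLm : AEStronglyMeasurable (fun z => |(L z).det|) (volume.restrict Z) :=
    ((ContinuousLinearMap.continuous_det.measurable.comp_aemeasurable
      (aemeasurable_fderivWithin volume hZm hderiv)).abs).aestronglyMeasurable
  have hdiff : IntegrableOn (fun z => |(L z).det| - D ⟪N p, z - p⟫) Z := by
    refine IntegrableOn.of_bound hZfin (hLm.sub hDint.aestronglyMeasurable) η ?_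
    exact (ae_restrict_iff' hZm).mpr (Eventually.of_forall hclose)
  have hLint : IntegrableOn (fun z => |(L z).det|) Z := by
    have := hdiff.add hDint
    refine this.congr (Eventually.of_forall fun z => ?_)
    simp
  rw [hcv, ← hDZ, ← integral_sub hLint hDint, ← hZreal, ← Real.norm_eq_abs]
  exact norm_setIntegral_le_of_norm_le_const hZfin hclose

end LocalDefining

end

/-! ### From local tubes to the whole boundary -/

section

variable {n : ℕ} {Ω : Set (E n)} {p : E n} {ε δ : ℝ}

theorem exists_one_lt_pow_le (n : ℕ) {κ : ℝ} (hκ : 0 < κ) :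
    ∃ K : ℝ≥0, 1 < K ∧ ((K : ℝ) ^ n - 1) * (K : ℝ) ^ n ≤ κ ∧ (K : ℝ) ^ n ≤ 2 := by
  have h1 : ∀ᶠ K : ℝ≥0 in 𝓝 1, ((K : ℝ) ^ n - 1) * (K : ℝ) ^ n < κ := by
    have : Continuous fun K : ℝ≥0 => ((K : ℝ) ^ n - 1) * (K : ℝ) ^ n := by fun_prop
    exact this.continuousAt.eventually (gt_mem_nhds (by simpa using hκ))
  have h2 : ∀ᶠ K : ℝ≥0 in 𝓝 1, (K : ℝ) ^ n < 2 := by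
    have : Continuous fun K : ℝ≥0 => (K : ℝ) ^ n := by fun_prop
    exact this.continuousAt.eventually (gt_mem_nhds (by simp))
  obtain ⟨K, hK, hK1⟩ := (((h1.and h2).filter_mono nhdsWithin_le_nhds).and
    (self_mem_nhdsWithin (a := (1 : ℝ≥0)) (s := Ioi 1))).exists
  exact ⟨K, hK1, hK.1.le, hK.2.le⟩

/-- The integral of `det (1 + t A_p)` over `0 ≤ t ≤ ε`. -/
def tubeDensity (Ω : Set (E n)) (ε : ℝ) (p : E n) : ℝ :=
  ∑ k ∈ Finset.range (n + 1), sCurv Ω k p * (ε ^ (k + 1) / (k + 1))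

theorem setIntegral_sum_sCurv (hε : 0 ≤ ε)
    (hpos : ∀ t ∈ Icc 0 ε, 0 ≤ ∑ k ∈ Finset.range (n + 1), sCurv Ω k p * t ^ k) :
    ∫ t in Ioc 0 ε, |∑ k ∈ Finset.range (n + 1), sCurv Ω k p * t ^ k| = tubeDensity Ω ε p := by
  rw [setIntegral_congr_fun measurableSet_Ioc fun t ht => abs_of_nonneg (hpos t ⟨ht.1.le, ht.2⟩),
    ← intervalIntegral.integral_of_le hε, intervalIntegral.integral_finsetSum]
  · refine Finset.sum_congr rfl fun k _ => ?_
    rw [intervalIntegral.integral_const_mul, integral_pow]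
    simp
  · intro k _
    exact (by fun_prop : Continuous fun t : ℝ => sCurv Ω k p * t ^ k).intervalIntegrable _ _

namespace IsBoundedC2Domain

/-- Locally the boundary is a Lipschitz image of a bounded piece of a hyperplane; compactness does
the rest. -/
theorem measure_frontier_lt_top (hΩ : IsBoundedC2Domain Ω) :
    Measure.euclideanHausdorffMeasure n (frontier Ω) < ∞ := by
  refine hΩ.isCompact_frontier.measure_lt_top_of_nhdsWithin fun p hp => ?_
  obtain ⟨U, ρ, N, hpU, h⟩ := hΩ.exists_localDefining hp
  obtain ⟨φ, H, hc⟩ := h.exists_flatteningChart hΩ.isOpen hpU hp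
  obtain ⟨V, hV, -, -, hB⟩ := hc.measure_flatCoord_image (h.norm_normal p hpU) (K := 2)
    one_lt_two
  refine ⟨V ∩ frontier Ω, inter_mem (mem_nhdsWithin_of_mem_nhds hV) self_mem_nhdsWithin, ?_⟩
  obtain ⟨h1, -, h2⟩ := hB _ Subset.rfl
  exact h2.trans_lt (ENNReal.mul_lt_top (ENNReal.pow_lt_top ENNReal.coe_lt_top) h1)

theorem exists_tube_volume (hΩ : IsBoundedC2Domain Ω) (hε : 0 ≤ ε)
    (hinj : InjOn (normalExp Ω) (frontier Ω ×ˢ Ioc 0 ε)) (hp : p ∈ frontier Ω)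
    (hpos : ∀ t ∈ Icc 0 ε, 0 ≤ ∑ k ∈ Finset.range (n + 1), sCurv Ω k p * t ^ k) (hδ : 0 < δ) :
    ∃ V ∈ 𝓝 p, ∀ B ⊆ V ∩ frontier Ω, MeasurableSet B →
      |volume.real (normalExp Ω '' (B ×ˢ Ioc 0 ε)) -
        (Measure.euclideanHausdorffMeasure n).real B * tubeDensity Ω ε p| ≤
        δ * (Measure.euclideanHausdorffMeasure n).real B := by
  obtain ⟨U, ρ, N, hpU, h⟩ := hΩ.exists_localDefining hp
  obtain ⟨φ, H, hc⟩ := h.exists_flatteningChart hΩ.isOpen hpU hp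
  set f := tubeDensity Ω ε p with hf
  -- The error is split evenly: `δ / 2` for replacing flat measure by Hausdorff measure, weighted by
  -- `|f|`, and `δ / 2` for the Jacobian, where `K ^ n ≤ 2` bounds flat measure by twice Hausdorff
  -- measure.
  obtain ⟨K, hK1, hK2, hK3⟩ := exists_one_lt_pow_le n
    (κ := δ / (2 * (|f| + 1))) (by positivity)
  obtain ⟨V, hV, hVc, hVi, hVB⟩ := hc.measure_flatCoord_image (h.norm_normal p hpU) hK1
  obtain ⟨V', hV', hVB'⟩ := h.exists_tube_volume_flat hΩ.isOpen hpU hc hε hinj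
    (η := δ / (4 * (ε + 1))) (by positivity)
  refine ⟨V ∩ V', inter_mem hV hV', fun B hB hBm => ?_⟩
  have hBV : B ⊆ V ∩ frontier Ω := fun x hx => ⟨(hB hx).1.1, (hB hx).2⟩
  have hBV' : B ⊆ V' ∩ frontier Ω := fun x hx => ⟨(hB hx).1.2, (hB hx).2⟩
  obtain ⟨hfin, hle1, hle2⟩ := hVB B hBV
  have hm := hVB' B hBV' (hBm.image_of_continuousOn_injOn
    (hVc.mono fun x hx => (hB hx).1.1) (hVi.mono hBV)) hfin
  simp_rw [← h.sum_sCurv_eq_det hΩ.isOpen hpU hp] at hm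
  rw [setIntegral_sum_sCurv hε hpos, ← hf] at hm
  have hfinB : Measure.euclideanHausdorffMeasure n B < ∞ :=
    (measure_mono fun x hx => (hB hx).2).trans_lt hΩ.measure_frontier_lt_top
  set b := volume.real (flatCoord p (N p) H '' B) with hb
  set m := (Measure.euclideanHausdorffMeasure n).real B with hmdef
  have hb0 : 0 ≤ b := measureReal_nonneg
  have hm0 : 0 ≤ m := measureReal_nonneg
  have hbm : b ≤ (K : ℝ) ^ n * m := by
    have := ENNReal.toReal_mono (ENNReal.mul_ne_top (ENNReal.pow_ne_top ENNReal.coe_ne_top)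
      hfinB.ne) hle1
    simpa [ENNReal.toReal_mul, ENNReal.toReal_pow, hb, hmdef, Measure.real] using this
  have hmb : m ≤ (K : ℝ) ^ n * b := by
    have := ENNReal.toReal_mono (ENNReal.mul_ne_top (ENNReal.pow_ne_top ENNReal.coe_ne_top)
      hfin.ne) hle2
    simpa [ENNReal.toReal_mul, ENNReal.toReal_pow, hb, hmdef, Measure.real] using this
  have hKn : 1 ≤ (K : ℝ) ^ n := one_le_pow₀ (by exact_mod_cast hK1.le)
  -- The two comparisons give `b - m ≤ (K ^ n - 1) m` and `m - b ≤ (K ^ n - 1) b ≤ (K ^ n - 1) K ^ n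
  -- m`.
  have hdiff : |b - m| ≤ δ / (2 * (|f| + 1)) * m := by
    have h1 : ((K : ℝ) ^ n - 1) * m ≤ ((K : ℝ) ^ n - 1) * (K : ℝ) ^ n * m := by
      have : 0 ≤ ((K : ℝ) ^ n - 1) * m := mul_nonneg (by linarith) hm0
      nlinarith
    have h2 : ((K : ℝ) ^ n - 1) * (K : ℝ) ^ n * m ≤ δ / (2 * (|f| + 1)) * m := by gcongr
    have h3 : ((K : ℝ) ^ n - 1) * b ≤ ((K : ℝ) ^ n - 1) * ((K : ℝ) ^ n * m) :=
      mul_le_mul_of_nonneg_left hbm (by linarith)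
    rw [abs_le]
    constructor <;> nlinarith
  have h1 : |b * f - m * f| ≤ δ / 2 * m := by
    rw [← sub_mul, abs_mul]
    calc |b - m| * |f| ≤ δ / (2 * (|f| + 1)) * m * |f| := by gcongr
      _ = δ / 2 * m * (|f| / (|f| + 1)) := by field_simp
      _ ≤ δ / 2 * m * 1 := by
        gcongr
        rw [div_le_one (by positivity)]
        linarith
      _ = _ := mul_one _
  have h2 : δ / (4 * (ε + 1)) * (b * ε) ≤ δ / 2 * m := by
    calc δ / (4 * (ε + 1)) * (b * ε) ≤ δ / (4 * (ε + 1)) * (2 * m * ε) := by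
          gcongr
          exact hbm.trans (by gcongr)
      _ = δ / 2 * m * (ε / (ε + 1)) := by field_simp; ring
      _ ≤ δ / 2 * m * 1 := by
        gcongr
        rw [div_le_one (by positivity)]
        linarith
      _ = _ := mul_one _
  calc _ ≤ _ := abs_sub_le _ (b * f) _
    _ ≤ δ / 2 * m + δ / 2 * m := add_le_add (hm.trans h2) h1
    _ = δ * m := by ring

theorem integrableOn_of_continuousOn (hΩ : IsBoundedC2Domain Ω) {g : E n → ℝ}
    (hg : ContinuousOn g (frontier Ω)) :
    IntegrableOn g (frontier Ω) (Measure.euclideanHausdorffMeasure n) := by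
  obtain ⟨M, hM⟩ := hΩ.isCompact_frontier.exists_bound_of_continuousOn hg
  exact IntegrableOn.of_bound hΩ.measure_frontier_lt_top
    (hg.aestronglyMeasurable isClosed_frontier.measurableSet) M
    ((ae_restrict_iff' isClosed_frontier.measurableSet).mpr (Eventually.of_forall hM))

theorem continuousOn_tubeDensity (hΩ : IsBoundedC2Domain Ω) (ε : ℝ) :
    ContinuousOn (tubeDensity Ω ε) (frontier Ω) :=
  continuousOn_finsetSum _ fun _ hk =>
    (hΩ.continuousOn_sCurv (Nat.lt_succ_iff.mp (Finset.mem_range.mp hk))).mul continuousOn_const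

theorem measurableSet_tube (hΩ : IsBoundedC2Domain Ω)
    (hinj : InjOn (normalExp Ω) (frontier Ω ×ˢ Ioc 0 ε)) {B : Set (E n)} (hB : B ⊆ frontier Ω)
    (hBm : MeasurableSet B) : MeasurableSet (normalExp Ω '' (B ×ˢ Ioc 0 ε)) :=
  (hBm.prod measurableSet_Ioc).image_of_continuousOn_injOn
    ((hΩ.continuousOn_normalExp _).mono (prod_mono_left hB)) (hinj.mono (prod_mono_left hB))

theorem volume_tube_lt_top (hΩ : IsBoundedC2Domain Ω) {B : Set (E n)} (hB : B ⊆ frontier Ω) :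
    volume (normalExp Ω '' (B ×ˢ Ioc 0 ε)) < ∞ := by
  have h1 := (hΩ.isCompact_frontier.prod (isCompact_Icc (a := 0) (b := ε))).image_of_continuousOn
    (hΩ.continuousOn_normalExp _)
  exact (measure_mono (image_mono (Set.prod_mono hB Ioc_subset_Icc_self))).trans_lt h1.measure_lt_top

/-- The volume of an injective one-sided tube about the boundary. -/
theorem volume_tube (hΩ : IsBoundedC2Domain Ω) (hε : 0 ≤ ε)
    (hinj : InjOn (normalExp Ω) (frontier Ω ×ˢ Ioc 0 ε))
    (hpos : ∀ p ∈ frontier Ω, ∀ t ∈ Icc 0 ε,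
      0 ≤ ∑ k ∈ Finset.range (n + 1), sCurv Ω k p * t ^ k) :
    volume.real (normalExp Ω '' (frontier Ω ×ˢ Ioc 0 ε)) =
      ∫ p, tubeDensity Ω ε p ∂(surfaceMeasure Ω) := by
  set μ : Measure (E n) := Measure.euclideanHausdorffMeasure n with hμ
  have hint := hΩ.integrableOn_of_continuousOn (hΩ.continuousOn_tubeDensity ε)
  have hfin : ∀ B ⊆ frontier Ω, μ B < ∞ := fun B hB =>
    (measure_mono hB).trans_lt hΩ.measure_frontier_lt_top
  have key : ∀ δ : ℝ, 0 < δ → |volume.real (normalExp Ω '' (frontier Ω ×ˢ Ioc 0 ε)) -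
      ∫ p in frontier Ω, tubeDensity Ω ε p ∂μ| ≤ δ * μ.real (frontier Ω) := by
    intro δ hδ
    -- Quantifying over all measurable `B` lets a union be handled by cutting `B` into `B ∩ s'` and
    -- `B \ s'`. The measurable superset `s'` makes these pieces measurable although the sets in the
    -- compactness induction are arbitrary.
    have hloc : ∃ s', frontier Ω ⊆ s' ∧ MeasurableSet s' ∧
        ∀ B ⊆ s' ∩ frontier Ω, MeasurableSet B →
        |volume.real (normalExp Ω '' (B ×ˢ Ioc 0 ε)) - ∫ p in B, tubeDensity Ω ε p ∂μ| ≤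
          δ * μ.real B := by
      refine hΩ.isCompact_frontier.induction_on (p := fun s => ∃ s', s ⊆ s' ∧ MeasurableSet s' ∧
        ∀ B ⊆ s' ∩ frontier Ω, MeasurableSet B →
        |volume.real (normalExp Ω '' (B ×ˢ Ioc 0 ε)) - ∫ p in B, tubeDensity Ω ε p ∂μ| ≤
          δ * μ.real B) ?_ ?_ ?_ ?_
      · refine ⟨∅, Subset.rfl, MeasurableSet.empty, fun B hB _ => ?_⟩
        have : B = ∅ := by simpa using hB
        simp [this]
      · rintro s t hst ⟨s', h1, h2⟩
        exact ⟨s', hst.trans h1, h2⟩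
      · rintro s t ⟨s', hs, hsm, hsB⟩ ⟨t', ht, htm, htB⟩
        refine ⟨s' ∪ t', union_subset_union hs ht, hsm.union htm, fun B hB hBm => ?_⟩
        have hBf : B ⊆ frontier Ω := fun x hx => (hB hx).2
        have hm1 := hBm.inter hsm
        have hm2 := hBm.diff hsm
        have hd : Disjoint (B ∩ s') (B \ s') :=
          disjoint_left.mpr fun x hx hx' => hx'.2 hx.2
        have hu : B ∩ s' ∪ B \ s' = B := inter_union_sdiff B s'
        have hf1 : B ∩ s' ⊆ frontier Ω := inter_subset_left.trans hBf
        have hf2 : B \ s' ⊆ frontier Ω := sdiff_subset.trans hBf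
        have h1 := hsB (B ∩ s') (fun x hx => ⟨hx.2, hBf hx.1⟩) hm1
        have h2 := htB (B \ s') (fun x hx => ⟨(hB hx.1).1.resolve_left hx.2, hBf hx.1⟩) hm2
        have hv : volume.real (normalExp Ω '' (B ×ˢ Ioc 0 ε)) =
            volume.real (normalExp Ω '' ((B ∩ s') ×ˢ Ioc 0 ε)) +
            volume.real (normalExp Ω '' ((B \ s') ×ˢ Ioc 0 ε)) := by
          rw [← measureReal_union _ (hΩ.measurableSet_tube hinj hf2 hm2)
            (hΩ.volume_tube_lt_top hf1).ne (hΩ.volume_tube_lt_top hf2).ne, ← image_union,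
            ← union_prod, hu]
          exact (disjoint_prod.mpr (Or.inl hd)).image hinj (prod_mono_left hf1)
            (prod_mono_left hf2)
        have hI : ∫ p in B, tubeDensity Ω ε p ∂μ = (∫ p in B ∩ s', tubeDensity Ω ε p ∂μ) +
            ∫ p in B \ s', tubeDensity Ω ε p ∂μ := by
          rw [← setIntegral_union hd hm2 (hint.mono_set hf1) (hint.mono_set hf2), hu]
        have hμB : μ.real B = μ.real (B ∩ s') + μ.real (B \ s') := by
          rw [← measureReal_union hd hm2 (hfin _ hf1).ne (hfin _ hf2).ne, hu]
        rw [hv, hI, hμB, mul_add, add_sub_add_comm]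
        exact (abs_add_le _ _).trans (add_le_add h1 h2)
      · intro p hp
        obtain ⟨V, hV, hVB⟩ := hΩ.exists_tube_volume hε hinj hp (hpos p hp) (half_pos hδ)
        have hcont := hΩ.continuousOn_tubeDensity ε p hp
        obtain ⟨V', hV', hVf⟩ := mem_nhdsWithin_iff_exists_mem_nhds_inter.mp
          (hcont.eventually (Metric.ball_mem_nhds _ (half_pos hδ)))
        obtain ⟨O, hO, hOo, hpO⟩ := _root_.mem_nhds_iff.mp (inter_mem hV hV')
        refine ⟨O, mem_nhdsWithin_of_mem_nhds (hOo.mem_nhds hpO), O, Subset.rfl,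
          hOo.measurableSet, fun B hB hBm => ?_⟩
        have hBf : B ⊆ frontier Ω := fun x hx => (hB hx).2
        have h1 := hVB B (fun x hx => ⟨(hO (hB hx).1).1, (hB hx).2⟩) hBm
        have h2 : |μ.real B * tubeDensity Ω ε p - ∫ q in B, tubeDensity Ω ε q ∂μ| ≤
            δ / 2 * μ.real B := by
          have h3 : μ.real B * tubeDensity Ω ε p = ∫ _ in B, tubeDensity Ω ε p ∂μ := by
            rw [setIntegral_const, smul_eq_mul]
          have h5 : IntegrableOn (fun _ : E n => tubeDensity Ω ε p) B μ :=
            integrableOn_const (hfin B hBf).ne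
          rw [h3, ← integral_sub h5 (hint.mono_set hBf),
            ← Real.norm_eq_abs]
          refine norm_setIntegral_le_of_norm_le_const (hfin B hBf) fun q hq => ?_
          have h4 : tubeDensity Ω ε q ∈ ball (tubeDensity Ω ε p) (δ / 2) :=
            hVf ⟨(hO (hB hq).1).2, (hB hq).2⟩
          rw [mem_ball, dist_comm, dist_eq_norm] at h4
          exact h4.le
        calc _ ≤ _ := abs_sub_le _ (μ.real B * tubeDensity Ω ε p) _
          _ ≤ δ / 2 * μ.real B + δ / 2 * μ.real B := add_le_add h1 h2
          _ = δ * μ.real B := by ring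
    obtain ⟨s', hs, -, h⟩ := hloc
    exact h _ (subset_inter hs Subset.rfl) isClosed_frontier.measurableSet
  rw [surfaceMeasure, ← sub_eq_zero, ← abs_eq_zero]
  refine le_antisymm (le_of_forall_pos_le_add fun η hη => ?_) (abs_nonneg _)
  have h0 : 0 ≤ μ.real (frontier Ω) := measureReal_nonneg
  refine (key (η / (μ.real (frontier Ω) + 1)) (by positivity)).trans ?_
  rw [zero_add, div_mul_eq_mul_div, div_le_iff₀ (by positivity)]
  nlinarith

/-- Finite `n`-dimensional measure forces the `(n + 1)`-dimensional measure to vanish. -/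
theorem volume_frontier (hΩ : IsBoundedC2Domain Ω) : volume (frontier Ω) = 0 := by
  rcases Measure.euclideanHausdorffMeasure_zero_or_top (Nat.lt_succ_self n) (frontier Ω) with h | h
  · rwa [Nat.succ_eq_add_one, EuclideanSpace.euclideanHausdorffMeasure_eq_volume] at h
  · exact absurd h hΩ.measure_frontier_lt_top.ne

/-- Since `s_0 = 1` and the other `s_k` are bounded on the compact boundary, the remaining terms
stay below `1` in absolute value for small `t`. This removes the absolute value from the Jacobian.
-/
theorem exists_sum_sCurv_nonneg (hΩ : IsBoundedC2Domain Ω) :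
    ∃ r : ℝ, 0 < r ∧ ∀ p ∈ frontier Ω, ∀ t ∈ Icc 0 r,
      0 ≤ ∑ k ∈ Finset.range (n + 1), sCurv Ω k p * t ^ k := by
  have hev : ∀ᶠ t : ℝ in 𝓝 0, ∀ p ∈ frontier Ω,
      0 ≤ ∑ k ∈ Finset.range (n + 1), sCurv Ω k p * t ^ k := by
    have hb : ∀ k ∈ Finset.range (n + 1), ∃ M : ℝ, ∀ p ∈ frontier Ω, ‖sCurv Ω k p‖ ≤ M :=
      fun k hk => hΩ.isCompact_frontier.exists_bound_of_continuousOn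
        (hΩ.continuousOn_sCurv (Nat.lt_succ_iff.mp (Finset.mem_range.mp hk)))
    choose! M hM using hb
    have hc : Continuous fun t : ℝ => ∑ k ∈ Finset.range n, M (k + 1) * |t| ^ (k + 1) := by
      fun_prop
    filter_upwards [(hc.tendsto' 0 0 (by simp)).eventually (gt_mem_nhds one_pos)] with t ht p hp
    rw [Finset.sum_range_succ']
    have h0 : sCurv Ω 0 p = 1 := by simp [sCurv, Multiset.esymm]
    have h1 : |∑ k ∈ Finset.range n, sCurv Ω (k + 1) p * t ^ (k + 1)| ≤
        ∑ k ∈ Finset.range n, M (k + 1) * |t| ^ (k + 1) := by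
      refine (Finset.abs_sum_le_sum_abs _ _).trans (Finset.sum_le_sum fun k hk => ?_)
      rw [abs_mul, abs_pow]
      gcongr
      exact hM (k + 1) (by simpa using hk) p hp
    rw [h0]
    have := (abs_le.mp (h1.trans ht.le)).1
    simp only [pow_zero, mul_one]
    linarith
  obtain ⟨r, hr, hball⟩ := Metric.eventually_nhds_iff.mp hev
  refine ⟨r / 2, half_pos hr, fun p hp t ht => hball ?_ p hp⟩
  rw [Real.dist_eq, sub_zero, abs_of_nonneg ht.1]
  linarith [ht.2]

end IsBoundedC2Domain

theorem integral_tubeDensity (hΩ : IsBoundedC2Domain Ω) (ε : ℝ) :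
    ∫ p, tubeDensity Ω ε p ∂(surfaceMeasure Ω) =
      ∑ k ∈ Finset.range (n + 1), ((n + 1).choose (k + 1) : ℝ) * W Ω (k + 1) * ε ^ (k + 1) := by
  unfold tubeDensity
  rw [integral_finsetSum]
  · refine Finset.sum_congr rfl fun k hk => ?_
    have hk' : k ≤ n := Nat.lt_succ_iff.mp (Finset.mem_range.mp hk)
    rw [integral_mul_const, W]
    -- This identity cancels the normalization of `W` against the `1 / (k + 1)` from integrating `t
    -- ^ k`.
    have h1 : ((n : ℝ) + 1) * (n.choose k : ℝ) = ((n + 1).choose (k + 1) : ℝ) * (k + 1) := by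
      exact_mod_cast Nat.add_one_mul_choose_eq n k
    have h2 : ((n + 1).choose (k + 1) : ℝ) ≠ 0 := by
      exact_mod_cast (Nat.choose_pos (by omega)).ne'
    have h3 : (k : ℝ) + 1 ≠ 0 := by positivity
    rw [h1]
    field_simp
  · intro k hk
    exact (hΩ.integrableOn_of_continuousOn
      (hΩ.continuousOn_sCurv (Nat.lt_succ_iff.mp (Finset.mem_range.mp hk)))).mul_const _

end

end SteinerFormula

end

/-! ### The Steiner formula -/

theorem mainTheorem4 (n : ℕ) (Ω : Set (SteinerFormula.E n))
    (hΩ : SteinerFormula.IsBoundedC2Domain Ω) :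
    (∀ k ∈ Finset.Icc 1 (n + 1),
      Integrable (SteinerFormula.sCurv Ω (k - 1)) (SteinerFormula.surfaceMeasure Ω)) ∧
    ∃ ε₀ : ℝ, 0 < ε₀ ∧ ∀ ε : ℝ, 0 ≤ ε → ε < ε₀ →
      volume.real (SteinerFormula.parallelBody (closure Ω) ε) =
        ∑ k ∈ Finset.range (n + 2),
          ((n + 1).choose k : ℝ) * SteinerFormula.W Ω k * ε ^ k := by
  refine ⟨fun k hk => ?_, ?_⟩
  · exact hΩ.integrableOn_of_continuousOn
      (hΩ.continuousOn_sCurv (by have := Finset.mem_Icc.mp hk; omega))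
  obtain ⟨C, hC0, hC⟩ := hΩ.exists_abs_inner_le
  obtain ⟨r, hr, hpos⟩ := hΩ.exists_sum_sCurv_nonneg
  -- `r` keeps the Jacobian nonnegative; `1 / (2 C + 1)` guarantees `2 C ε < 1` and is meaningful
  -- even if `C = 0`.
  refine ⟨min r (1 / (2 * C + 1)), by positivity, fun ε hε hεlt => ?_⟩
  have hεr : ε < r := hεlt.trans_le (min_le_left _ _)
  have hεC : 2 * C * ε < 1 := by
    have h1 := hεlt.trans_le (min_le_right _ _)
    rw [lt_div_iff₀ (by positivity)] at h1
    nlinarith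
  have hinj := hΩ.injOn_normalExp hC hC0 hεC
  have htube := hΩ.volume_tube hε hinj fun p hp t ht => hpos p hp t ⟨ht.1, ht.2.trans hεr.le⟩
  have hsub : closure Ω ⊆ SteinerFormula.parallelBody (closure Ω) ε := fun x hx =>
    (infDist_zero_of_mem hx).trans_le hε
  have hcl : volume.real (closure Ω) = volume.real Ω := by
    refine congrArg ENNReal.toReal (le_antisymm ?_ (measure_mono subset_closure))
    rw [closure_eq_self_union_frontier]
    exact (measure_union_le _ _).trans (by rw [hΩ.volume_frontier, add_zero])
  have hdiff := hΩ.parallelBody_diff_closure hC hC0 hεC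
  have hadd : volume.real (SteinerFormula.parallelBody (closure Ω) ε) =
      volume.real (closure Ω) +
        volume.real (SteinerFormula.normalExp Ω '' (frontier Ω ×ˢ Set.Ioc 0 ε)) := by
    rw [← measureReal_union _ (hΩ.measurableSet_tube hinj Set.Subset.rfl
      isClosed_frontier.measurableSet) hΩ.isCompact_closure.measure_lt_top.ne
      (hΩ.volume_tube_lt_top Set.Subset.rfl).ne, ← hdiff, Set.union_sdiff_cancel hsub]
    rw [← hdiff]
    exact Set.disjoint_sdiff_right
  rw [hadd, htube, hcl, SteinerFormula.integral_tubeDensity hΩ, Finset.sum_range_succ' _ (n + 1),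
    add_comm]
  simp [show SteinerFormula.W Ω 0 = volume.real Ω from rfl]
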